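/- \textbf{Noise model.} Let $d\ge 1$, $L,m,q\ge 0$ be integers and $(\Omega,\mathcal F,\mathbb P)$ a probability space. For $\ell=0,\dots,L$ and $t\in\mathbb Z$ let $\varepsilon^{(\ell)}_t$ be $d$-dimensional random vectors, independent over all pairs $(\ell,t)$, of the form $\varepsilon_t^{(\ell)}=(\Sigma_t^{(\ell)})^{1/2}u_t^{(\ell)}$ with $\Sigma_t^{(\ell)}$ symmetric positive definite and $u_t^{(\ell)}$ a mean zero random vector with independent coordinates, such that (a) $\sup_{\ell,t,\nu}\mathbb E|\varepsilon_t^{(\ell,\nu)}|^4<\infty$; (b) if $d=1$, $\inf_t \mathbb E(\varepsilon_t^{(0)})^2>0$, and if $d>1$, $\inf_t\lambda_{\min}(\Sigma^{(0)}_t)>0$; (c) every coordinate $\varepsilon_t^{(\ell,\nu)}$ has a Lebesgue density $p_t^{(\ell,\nu)}$, and for all $\ell,\nu$ there is $K$ with $\int|p_t^{(\ell,\nu)}(z+x)-p_t^{(\ell,\nu)}(z)|\,dz\le K|x|$ for all $t\ge1$, $x\in\mathbb R$. Let $C_j^{(\ell)}$ ($j\ge 0$, $0\le\ell\le L$) be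 $d\times d$ matrices whose entries are bounded in absolute value by $C\max(j,1)^{-7/2-\theta}$ for some constants $C$ and $\theta\ge 3/2$, and put $F_t^{(\ell)}=\sum_{j\ge0}C_j^{(\ell)}\varepsilon^{(\ell)}_{t-j}$. For a site $s\in[0,1]^q$ let $U_t(s)$ be the $d$-vector with coordinates $$U_t^{(\nu)}(s)=\sum_{\ell=1}^L\phi_{\nu\ell}\,w(s,r_\ell)F_t^{(\ell,\nu)}+F_t^{(0,\nu)},$$ where $\phi_{\nu\ell}\in\mathbb R$, $r_\ell\in[0,1]^q$, and $w:[0,1]^q\times[0,1]^q\to[0,1]$ is a nonincreasing function of the distance of its arguments (in some norm) with $w(u,u)=1$. Let $H=(H_1,\dots,H_d):\mathbb R^{d\times(m+1)}\to\mathbb R^d$ have coordinates that are Lipschitz with respect to the Frobenius norm, let $s_{t,i}\in[0,1]^q$ be sites (for example $s_{t,i}=s_t$ or $s_{t,i}=s_{t-i}$ for a path $(s_t)$), and put $$\epsilon_t=H(U_t(s_{t,0}),\dots,U_{t-m}(s_{t,m}))-\mathbb E\,H(U_t(s_{t,0}),\dots,U_{t-m}(s_{t,m})).$$ \textbf{Regressors.}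 Let $x_{tj}\in\mathbb R$ ($t,j\ge 1$) be a bounded array, $X_{T,p}=(x_{tj})_{1\le t\le T,\,1\le j\le p}$ with rows $x_t^\top$, and let $S$ be a set of pairs $(T,p)$ of positive integers such that for positive definite $\Sigma_p\in\mathbb R^{p\times p}$, constants $C<\infty$, $\eta\ge 0$ and a compact interval $A\subset(0,\infty)$, $$\|T^{-1}X_{T,p}^\top X_{T,p}-\Sigma_p\|_2\le C\,p^\eta/\sqrt T\quad\text{and}\quad \operatorname{spec}(T^{-1}X_{T,p}^\top X_{T,p})\subset A\qquad\text{for all }(T,p)\in S.$$ \textbf{Estimator.} Fix $\nu\in\{1,\dots,d\}$. For $(T,p)\in S$, $\beta\in\mathbb R^p$, $\lambda\ge0$ and $1\le s\le 2$ let $Y_t=x_t^\top\beta+\epsilon_t^{(\nu)}$, $1\le t\le T$, let $\hat\beta$ be any minimizer over $b\in\mathbb R^p$ of $T^{-1}\|Y-X_{T,p}b\|_2^2+\lambda\|b\|_s$, where $\|b\|_s=(\sum_j|b_j|^s)^{1/s}$, and let $\widehat{\mathrm{MSPE}}=T^{-1}\sum_{t=1}^T(x_t^\top\hat\beta-x_t^\top\beta)^2$.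 Put $\lambda_{T,p}(\alpha)=(C_\nu/\alpha)^{1/2}\sqrt{p/T}$. \textbf{Theorem.} There is a constant $C_0>0$, not depending on $\alpha,s,T,p,\beta$, such that for every $C_\nu\ge C_0$ the following hold. (1) $\mathbb E\bigl|\sum_{t=1}^N x_{tj}\epsilon_t^{(\nu)}\bigr|^2\le C_\nu N$ for all $N\ge 0$ and $j\ge 1$. (2) For all $\alpha\in(0,1)$, $1\le s\le2$, $(T,p)\in S$ and $\beta\in\mathbb R^p$, the choice $\lambda=\lambda_{T,p}(\alpha)$ ensures that with probability at least $1-\alpha$ $$\widehat{\mathrm{MSPE}}\le 2\,(C_\nu/\alpha)^{1/2}\sqrt{p/T}\,\|\beta\|_s .$$ (3) Let $\alpha\in(0,1)$, $1\le s\le 2$, $(T_n,p_n)\in S$ with $T_n\to\infty$, $\beta_n\in\mathbb R^{p_n}$, and $\lambda_n=\lambda_{T_n,p_n}(\alpha)$. If $p_n=o(T_n)$ and $\|\beta_n\|_s=O(1)$, then $\widehat{\mathrm{MSPE}}\to0$ in probability as $n\to\infty$. (4) Let $\alpha_n\in(0,1)$ (for instance constant), $1\le s\le 2$, $(T_n,p_n)\in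 S$ with $T_n\to\infty$ and $p_n\to\infty$, $\beta_n\in\mathbb R^{p_n}$, and $\lambda_n=\lambda_{T_n,p_n}(\alpha_n)$. If $\|\beta_n\|_s=o\bigl(\lambda_n^{-1}\bigr)$, then $\widehat{\mathrm{MSPE}}\to0$ in probability as $n\to\infty$. -/

import Mathlib

open MeasureTheory ProbabilityTheory Filter Matrix
open scoped ENNReal Topology

noncomputable section

/-- Data of the spatial-temporal noise model. The index `0 : Fin (L + 1)` is the idiosyncratic noise,
`ℓ.succ` is the `ℓ`-th factor. -/
structure ErrorModel (d L m q : ℕ) (Ω : Type*) where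
  /-- `innov ℓ t` is the `d`-dimensional innovation of the `ℓ`-th linear process at time `t`. -/
  innov : Fin (L + 1) → ℤ → Ω → Fin d → ℝ
  /-- `coef ℓ j` is the coefficient matrix of lag `j` of the `ℓ`-th linear process. -/
  coef : Fin (L + 1) → ℕ → Matrix (Fin d) (Fin d) ℝ
  /-- factor loadings -/
  load : Fin d → Fin L → ℝ
  /-- `weight s r` is the effect at the site `s` of a factor located at `r`. -/
  weight : (Fin q → ℝ) → (Fin q → ℝ) → ℝ
  /-- the sites of the factors -/
  source : Fin L → Fin q → ℝ
  /-- `pos t i` is the site at which the `i`-th lag entering the error at time `t` is observed: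
  `pos t i = s t` when the error field is sampled at `s t`, and `pos t i = s (t - i)` when each lag
  is taken at the site visited at its own time. -/
  pos : ℤ → Fin (m + 1) → Fin q → ℝ
  /-- the nonlinearity, a function of `m + 1` consecutive `d`-vectors -/
  H : (Fin (m + 1) → Fin d → ℝ) → Fin d → ℝ

namespace ErrorModel

variable {d L m q : ℕ} {Ω : Type*}

/-- The linear process `∑_{j ≥ 0} C_j ε_{t-j}` of the `ℓ`-th source, coordinate `ν`. -/
def linProc (M : ErrorModel d L m q Ω) (ℓ : Fin (L + 1)) (t : ℤ) (ω : Ω) (ν : Fin d) : ℝ :=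
  ∑' j : ℕ, (M.coef ℓ j *ᵥ M.innov ℓ (t - j) ω) ν

/-- The linear factor field `U_t(s)`. -/
def field (M : ErrorModel d L m q Ω) (s : Fin q → ℝ) (t : ℤ) (ω : Ω) (ν : Fin d) : ℝ :=
  ∑ ℓ : Fin L, M.load ν ℓ * M.weight s (M.source ℓ) * M.linProc ℓ.succ t ω ν + M.linProc 0 t ω ν

/-- The tuple `(U_t, U_{t-1}, …, U_{t-m})` observed at time `t`. -/
def lagged (M : ErrorModel d L m q Ω) (t : ℤ) (ω : Ω) : Fin (m + 1) → Fin d → ℝ :=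
  fun i => M.field (M.pos t i) (t - (i : ℕ)) ω

variable [MeasurableSpace Ω]

/-- The error term: the centred nonlinear transform of the observed field. -/
def err (M : ErrorModel d L m q Ω) (μ : Measure Ω) (t : ℤ) (ω : Ω) (ν : Fin d) : ℝ :=
  M.H (M.lagged t ω) ν - ∫ ω', M.H (M.lagged t ω') ν ∂μ

/-- The innovations are symmetric square roots of positive definite matrices applied to mean zero
vectors with independent coordinates, and the idiosyncratic innovations are non-degenerate. -/
def InnovationStructure (M : ErrorModel d L m q Ω) (μ : Measure Ω) : Prop :=
  ∃ (Sig R : Fin (L + 1) → ℤ → Matrix (Fin d) (Fin d) ℝ) (u : Fin (L + 1) → ℤ → Ω → Fin d → ℝ),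
    (∀ ℓ t, (Sig ℓ t).PosDef ∧ (R ℓ t).PosSemidef ∧ R ℓ t * R ℓ t = Sig ℓ t) ∧
    (∀ ℓ t ω, M.innov ℓ t ω = R ℓ t *ᵥ u ℓ t ω) ∧
    (∀ ℓ t ν, Measurable (fun ω => u ℓ t ω ν)) ∧
    (∀ ℓ t ν, Integrable (fun ω => u ℓ t ω ν) μ ∧ ∫ ω, u ℓ t ω ν ∂μ = 0) ∧
    (∀ ℓ t, iIndepFun (fun (ν : Fin d) ω => u ℓ t ω ν) μ) ∧
    (d = 1 → ∃ σ : ℝ, 0 < σ ∧ ∀ t ν, σ ^ 2 ≤ ∫ ω, (M.innov 0 t ω ν) ^ 2 ∂μ) ∧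
    (1 < d → ∃ lamMin : ℝ, 0 < lamMin ∧ ∀ t, ∀ κ ∈ spectrum ℝ (Sig 0 t), lamMin ≤ κ)

/-- All innovation coordinates have densities whose `L¹`-modulus of continuity is `O(|x|)`,
uniformly over the times `t ≥ 1`. -/
def InnovationDensities (M : ErrorModel d L m q Ω) (μ : Measure Ω) : Prop :=
  ∀ ℓ ν, ∃ f : ℤ → ℝ → ℝ,
    (∀ t, Measurable (f t) ∧ (∀ z, 0 ≤ f t z) ∧
      μ.map (fun ω => M.innov ℓ t ω ν) = volume.withDensity (fun z => ENNReal.ofReal (f t z))) ∧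
    ∃ K : ℝ, ∀ t : ℤ, 1 ≤ t → ∀ x : ℝ,
      ∫⁻ z, ‖f t (z + x) - f t z‖ₑ ≤ ENNReal.ofReal (K * |x|)

/-- The weight is a nonincreasing function of the distance (with respect to some norm) of two sites
of the unit cube, has values in the unit interval and equals `1` on the diagonal. -/
def WeightAssumption (M : ErrorModel d L m q Ω) : Prop :=
  (∀ u ∈ Set.Icc (0 : Fin q → ℝ) 1, ∀ v ∈ Set.Icc (0 : Fin q → ℝ) 1,
    M.weight u v ∈ Set.Icc (0 : ℝ) 1) ∧
  (∀ u ∈ Set.Icc (0 : Fin q → ℝ) 1, M.weight u u = 1) ∧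
  ∃ N : Seminorm ℝ (Fin q → ℝ), (∀ z, N z = 0 → z = 0) ∧
    ∀ u ∈ Set.Icc (0 : Fin q → ℝ) 1, ∀ v ∈ Set.Icc (0 : Fin q → ℝ) 1,
    ∀ u' ∈ Set.Icc (0 : Fin q → ℝ) 1, ∀ v' ∈ Set.Icc (0 : Fin q → ℝ) 1,
      N (u - v) ≤ N (u' - v') → M.weight u' v' ≤ M.weight u v

/-- The assumptions on the error process: fourth moments and algebraic decay of the coefficients. -/
structure Assumptions (M : ErrorModel d L m q Ω) (μ : Measure Ω) : Prop where
  measurable_innov : ∀ ℓ t, Measurable (M.innov ℓ t)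
  /-- independent sequences of independent random vectors -/
  indep : iIndepFun (fun (k : Fin (L + 1) × ℤ) => M.innov k.1 k.2) μ
  innovation : M.InnovationStructure μ
  fourth_moment : ∃ K : ℝ, ∀ ℓ t ν, ∫⁻ ω, ‖M.innov ℓ t ω ν‖ₑ ^ 4 ∂μ ≤ ENNReal.ofReal K
  densities : M.InnovationDensities μ
  decay : ∃ C θ : ℝ, 3 / 2 ≤ θ ∧ ∀ ℓ (j : ℕ) ν k,
    |M.coef ℓ j ν k| ≤ C * (max (j : ℝ) 1) ^ (-(7 / 2 : ℝ) - θ)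
  weight_ok : M.WeightAssumption
  source_mem : ∀ ℓ, M.source ℓ ∈ Set.Icc (0 : Fin q → ℝ) 1
  pos_mem : ∀ t i, M.pos t i ∈ Set.Icc (0 : Fin q → ℝ) 1
  lipschitz : ∃ LH : ℝ, ∀ (ν : Fin d) (y z : Fin (m + 1) → Fin d → ℝ),
    |M.H y ν - M.H z ν| ≤ LH * √(∑ i, ∑ k, (y i k - z i k) ^ 2)

end ErrorModel

/-- The design matrix with rows `x_1, …, x_T`; the columns are numbered `0, …, p - 1`. -/
def designMatrix (x : ℕ → ℕ → ℝ) (T p : ℕ) : Matrix (Fin T) (Fin p) ℝ :=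
  fun t j => x (t + 1) j

/-- The Gram matrix `T⁻¹ Xᵀ X = T⁻¹ ∑ₜ xₜ xₜᵀ`. -/
def gramMatrix (x : ℕ → ℕ → ℝ) (T p : ℕ) : Matrix (Fin p) (Fin p) ℝ :=
  (T : ℝ)⁻¹ • ((designMatrix x T p)ᵀ * designMatrix x T p)

/-- The assumption on the regressors over a set `S` of pairs `(T, p)` of sample size and dimension:
bounded regressors, approximation of positive definite matrices by the Gram matrices in the spectral
norm at the rate `p ^ η / √T`, and spectra of the Gram matrices in a compact subinterval
of `(0, ∞)`. -/
structure RegressorAssumptions (x : ℕ → ℕ → ℝ) (S : Set (ℕ × ℕ)) : Prop where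
  pos : ∀ T p, (T, p) ∈ S → 1 ≤ T ∧ 1 ≤ p
  bounded : ∃ B : ℝ, ∀ t j, |x t j| ≤ B
  gram : ∃ (Sig : ∀ p : ℕ, Matrix (Fin p) (Fin p) ℝ) (C η : ℝ),
    (∀ p, (Sig p).PosDef) ∧ 0 ≤ η ∧ ∀ T p, (T, p) ∈ S →
      ‖Matrix.toEuclideanCLM (𝕜 := ℝ) (gramMatrix x T p - Sig p)‖ ≤ C * ((p : ℝ) ^ η / √(T : ℝ))
  spec : ∃ a b : ℝ, 0 < a ∧ ∀ T p, (T, p) ∈ S → spectrum ℝ (gramMatrix x T p) ⊆ Set.Icc a b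

/-- The `ℓ_s` norm on `ℝᵖ`. -/
def lsNorm (s : ℝ) {p : ℕ} (b : Fin p → ℝ) : ℝ := (∑ j, |b j| ^ s) ^ (1 / s)

/-- The penalized least squares criterion `T⁻¹ ‖Y - X b‖₂² + lam ‖b‖_s`. -/
def lsCriterion {T p : ℕ} (X : Matrix (Fin T) (Fin p) ℝ) (Y : Fin T → ℝ) (lam s : ℝ)
    (b : Fin p → ℝ) : ℝ :=
  (T : ℝ)⁻¹ * ∑ t, (Y t - (X *ᵥ b) t) ^ 2 + lam * lsNorm s b

/-- The responses `Y_t = x_tᵀ β + ε_t`, `t = 1, …, T`, for the noise sequence `e`. -/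
def response (x : ℕ → ℕ → ℝ) (T p : ℕ) (β : Fin p → ℝ) (e : ℤ → ℝ) : Fin T → ℝ :=
  fun t => (designMatrix x T p *ᵥ β) t + e ((t : ℕ) + 1)

/-- `bhat` is an `ℓ_s`-penalized least squares estimator with regularization parameter `lam` based on
the regressors `x_1, …, x_T`, the true parameter `β` and the noise `e`. -/
def IsPenalizedLSE {Ω : Type*} (x : ℕ → ℕ → ℝ) (T p : ℕ) (β : Fin p → ℝ) (e : ℤ → Ω → ℝ)
    (lam s : ℝ) (bhat : Ω → Fin p → ℝ) : Prop :=
  ∀ ω, IsMinOn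
    (lsCriterion (designMatrix x T p) (response x T p β (fun t => e t ω)) lam s) Set.univ (bhat ω)

/-- The sample mean-square prediction error `T⁻¹ ∑ₜ (x_tᵀ b - x_tᵀ β)²`. -/
def sampleMSPE (x : ℕ → ℕ → ℝ) (T p : ℕ) (β b : Fin p → ℝ) : ℝ :=
  (T : ℝ)⁻¹ * ∑ t, ((designMatrix x T p *ᵥ b) t - (designMatrix x T p *ᵥ β) t) ^ 2

/-- The regularization parameter `(C / α)^{1/2} (p / T)^{1/2}`. -/
def regParam (C α : ℝ) (T p : ℕ) : ℝ := √(C / α) * √((p : ℝ) / (T : ℝ))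

end

/-!
Comparing the criterion at a minimizer `b̂` and at `β`, and using `‖·‖₂ ≤ ‖·‖_s` for `s ≤ 2`, the
bound `MSPE ≤ 2 λ ‖β‖_s` holds as soon as the score satisfies `4 ‖Xᵀ e‖₂² ≤ (T λ)²`, so everything
is about the size of `‖Xᵀ e‖₂²`.

The errors are Lipschitz functionals of the past of independent innovations, with lag weights
decaying like `h⁻⁴`. Clipping the innovations at the level `k + 1` and replacing those of lag at
least `k` by `0` gives bounded `k`-dependent approximations, whence
`|cov(e_s, e_t)| = O(|t - s|⁻²)` and `E (Xᵀ e)_j² ≤ C T`. Markov's inequality then bounds the MSPE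
with probability `1 - α`. If `p = o(T)`, the lower bound on the spectrum of the Gram matrix absorbs
the cross term of the basic inequality, and `‖Xᵀ e‖₂² / T² → 0` in probability.

In the high-dimensional regime Markov's inequality is not enough, since a constant `α` only gives
probability `1 - α`. For bounded `k`-dependent errors `‖Xᵀ e‖₂²` is a quadratic form whose variance
is of smaller order than `(p T)²` when `p, T → ∞`, because most of its terms are uncorrelated and
the upper bound on the spectrum controls the others; by Chebyshev's inequality `‖Xᵀ e‖₂²` is then
at most a constant times `p T` with probability tending to `1`. The error of the approximation
contributes at most a fraction `O(1 / k)` of `p T` on average, uniformly in `T` and `p`.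
-/

/-! ### Penalized least squares -/

theorem lsNorm_nonneg (s : ℝ) {p : ℕ} (b : Fin p → ℝ) : 0 ≤ lsNorm s b :=
  Real.rpow_nonneg (Finset.sum_nonneg fun _ _ => Real.rpow_nonneg (abs_nonneg _) _) _

theorem lsNorm_sub_le {s : ℝ} (hs : 1 ≤ s) {p : ℕ} (b c : Fin p → ℝ) :
    lsNorm s (b - c) ≤ lsNorm s b + lsNorm s c := by
  simpa [lsNorm, sub_eq_add_neg] using Real.Lp_add_le Finset.univ b (-c) hs

theorem lsNorm_rpow {s : ℝ} (hs : 0 < s) {p : ℕ} (b : Fin p → ℝ) :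
    lsNorm s b ^ s = ∑ j, |b j| ^ s := by
  have hsum : 0 ≤ ∑ j, |b j| ^ s :=
    Finset.sum_nonneg fun _ _ => Real.rpow_nonneg (abs_nonneg _) _
  rw [lsNorm, ← Real.rpow_mul hsum, one_div, inv_mul_cancel₀ hs.ne', Real.rpow_one]

theorem abs_le_lsNorm {s : ℝ} (hs : 0 < s) {p : ℕ} (b : Fin p → ℝ) (j : Fin p) :
    |b j| ≤ lsNorm s b := by
  rw [← Real.rpow_le_rpow_iff (abs_nonneg _) (lsNorm_nonneg s b) hs, lsNorm_rpow hs]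
  exact Finset.single_le_sum (f := fun j => |b j| ^ s)
    (fun _ _ => Real.rpow_nonneg (abs_nonneg _) _) (Finset.mem_univ j)

theorem sum_sq_le_lsNorm_sq {s : ℝ} (hs : s ∈ Set.Icc (1 : ℝ) 2) {p : ℕ} (b : Fin p → ℝ) :
    ∑ j, b j ^ 2 ≤ lsNorm s b ^ 2 := by
  have hs0 : 0 < s := by linarith [hs.1]
  have hs2 : 0 ≤ 2 - s := by linarith [hs.2]
  have sq_eq : ∀ u : ℝ, 0 ≤ u → u ^ 2 = u ^ s * u ^ (2 - s) := fun u hu => by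
    rw [← Real.rpow_add_of_nonneg hu hs0.le hs2, add_sub_cancel, Real.rpow_two]
  calc ∑ j, b j ^ 2 = ∑ j, |b j| ^ s * |b j| ^ (2 - s) :=
        Finset.sum_congr rfl fun j _ => by rw [← sq_abs, sq_eq _ (abs_nonneg _)]
    _ ≤ ∑ j, |b j| ^ s * lsNorm s b ^ (2 - s) := by
        gcongr with j
        exact abs_le_lsNorm hs0 b j
    _ = lsNorm s b ^ 2 := by
        rw [← Finset.sum_mul, ← lsNorm_rpow hs0, ← sq_eq _ (lsNorm_nonneg s b)]

/-- The `j`-th coordinate `∑_{1 ≤ t ≤ T} x_{tj} e_t` of the score vector `Xᵀ e` of the least squares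
criterion. -/
noncomputable def score (x : ℕ → ℕ → ℝ) (T : ℕ) (e : ℤ → ℝ) (j : ℕ) : ℝ :=
  ∑ t ∈ Finset.Icc 1 T, x t j * e t

/-- The squared Euclidean norm `‖Xᵀ e‖₂²` of the score vector in dimension `p`. -/
noncomputable def scoreSq (x : ℕ → ℕ → ℝ) (T p : ℕ) (e : ℤ → ℝ) : ℝ :=
  ∑ j ∈ Finset.range p, score x T e j ^ 2

theorem scoreSq_nonneg (x : ℕ → ℕ → ℝ) (T p : ℕ) (e : ℤ → ℝ) : 0 ≤ scoreSq x T p e :=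
  Finset.sum_nonneg fun _ _ => sq_nonneg _

theorem sum_Icc_one_eq_sum_fin (T : ℕ) (f : ℕ → ℝ) :
    ∑ t ∈ Finset.Icc 1 T, f t = ∑ t : Fin T, f (t + 1) := by
  rw [Fin.sum_univ_eq_sum_range (fun t => f (t + 1)), Finset.range_eq_Ico,
    Finset.sum_Ico_add' f 0 T 1]
  rfl

theorem sum_designMatrix_mulVec_mul (x : ℕ → ℕ → ℝ) (T p : ℕ) (e : ℤ → ℝ) (v : Fin p → ℝ) :
    ∑ t : Fin T, (designMatrix x T p *ᵥ v) t * e ((t : ℕ) + 1)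
      = ∑ j : Fin p, score x T e j * v j := by
  simp_rw [score, sum_Icc_one_eq_sum_fin, Matrix.mulVec, dotProduct, Finset.sum_mul]
  rw [Finset.sum_comm]
  refine Finset.sum_congr rfl fun _ _ => Finset.sum_congr rfl fun _ _ => ?_
  simp only [designMatrix, Nat.cast_add, Nat.cast_one]
  ring

theorem sum_score_mul_le (x : ℕ → ℕ → ℝ) (T p : ℕ) (e : ℤ → ℝ) (v : Fin p → ℝ) :
    ∑ j : Fin p, score x T e j * v j ≤ √(scoreSq x T p e) * √(∑ j, v j ^ 2) := by
  simpa only [scoreSq, Fin.sum_univ_eq_sum_range (fun j => score x T e j ^ 2)] using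
    Real.sum_mul_le_sqrt_mul_sqrt Finset.univ (fun j : Fin p => score x T e j) v

theorem sampleMSPE_eq (x : ℕ → ℕ → ℝ) (T p : ℕ) (β b : Fin p → ℝ) :
    sampleMSPE x T p β b = (T : ℝ)⁻¹ * ∑ t, ((designMatrix x T p *ᵥ (b - β)) t) ^ 2 := by
  simp [sampleMSPE, Matrix.mulVec_sub]

theorem sampleMSPE_nonneg (x : ℕ → ℕ → ℝ) (T p : ℕ) (β b : Fin p → ℝ) :
    0 ≤ sampleMSPE x T p β b :=
  mul_nonneg (by positivity) (Finset.sum_nonneg fun _ _ => sq_nonneg _)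

section BasicInequality

variable {x : ℕ → ℕ → ℝ} {T p : ℕ} {β b : Fin p → ℝ} {e : ℤ → ℝ} {lam s a : ℝ}

theorem sampleMSPE_le_of_isMinOn
    (h : IsMinOn (lsCriterion (designMatrix x T p) (response x T p β e) lam s) Set.univ b) :
    sampleMSPE x T p β b ≤ 2 * ((T : ℝ)⁻¹ * ∑ j : Fin p, score x T e j * (b - β) j)
      + lam * (lsNorm s β - lsNorm s b) := by
  have hmin : lsCriterion (designMatrix x T p) (response x T p β e) lam s b
      ≤ lsCriterion (designMatrix x T p) (response x T p β e) lam s β := h (Set.mem_univ β)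
  have expand : ∑ t : Fin T, (response x T p β e t - (designMatrix x T p *ᵥ b) t) ^ 2
      = ∑ t : Fin T, (response x T p β e t - (designMatrix x T p *ᵥ β) t) ^ 2
        - 2 * ∑ t : Fin T, (designMatrix x T p *ᵥ (b - β)) t * e ((t : ℕ) + 1)
        + ∑ t : Fin T, ((designMatrix x T p *ᵥ (b - β)) t) ^ 2 := by
    rw [Finset.mul_sum, ← Finset.sum_sub_distrib, ← Finset.sum_add_distrib]
    refine Finset.sum_congr rfl fun t _ => ?_
    rw [Matrix.mulVec_sub, Pi.sub_apply, response]
    ring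
  rw [lsCriterion, lsCriterion, expand, sum_designMatrix_mulVec_mul] at hmin
  rw [sampleMSPE_eq]
  linarith

theorem sampleMSPE_le_of_scoreSq_le (hT : 1 ≤ T) (hlam : 0 ≤ lam) (hs : s ∈ Set.Icc (1 : ℝ) 2)
    (h : IsMinOn (lsCriterion (designMatrix x T p) (response x T p β e) lam s) Set.univ b)
    (hQ : 4 * scoreSq x T p e ≤ (T * lam) ^ 2) :
    sampleMSPE x T p β b ≤ 2 * lam * lsNorm s β := by
  have hT' : (0 : ℝ) < T := by exact_mod_cast hT
  have noise_le : √(scoreSq x T p e) ≤ T * lam / 2 :=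
    Real.sqrt_le_iff.2 ⟨by positivity, by linarith⟩
  have norm_le : √(∑ j, (b - β) j ^ 2) ≤ lsNorm s b + lsNorm s β :=
    (Real.sqrt_le_iff.2 ⟨lsNorm_nonneg s _, sum_sq_le_lsNorm_sq hs _⟩).trans
      (lsNorm_sub_le hs.1 b β)
  have cross_le : (T : ℝ)⁻¹ * ∑ j : Fin p, score x T e j * (b - β) j
      ≤ lam / 2 * (lsNorm s b + lsNorm s β) := by
    calc (T : ℝ)⁻¹ * ∑ j : Fin p, score x T e j * (b - β) j
        ≤ (T : ℝ)⁻¹ * (T * lam / 2 * (lsNorm s b + lsNorm s β)) := by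
          gcongr
          exact (sum_score_mul_le x T p e (b - β)).trans (by gcongr)
      _ = lam / 2 * (lsNorm s b + lsNorm s β) := by field_simp
  linarith [sampleMSPE_le_of_isMinOn h]

theorem sampleMSPE_le_add_of_lower_bound (hT : 1 ≤ T) (hlam : 0 ≤ lam) (ha : 0 < a)
    (h : IsMinOn (lsCriterion (designMatrix x T p) (response x T p β e) lam s) Set.univ b)
    (hG : a * ∑ j, (b - β) j ^ 2 ≤ sampleMSPE x T p β b) :
    sampleMSPE x T p β b ≤ 4 * scoreSq x T p e / (a * T ^ 2) + 2 * lam * lsNorm s β := by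
  have hT' : (0 : ℝ) < T := by exact_mod_cast hT
  set u := √(scoreSq x T p e)
  set v := √(∑ j, (b - β) j ^ 2)
  have hu : u ^ 2 = scoreSq x T p e := Real.sq_sqrt (scoreSq_nonneg _ _ _ _)
  have hv : v ^ 2 = ∑ j, (b - β) j ^ 2 :=
    Real.sq_sqrt (Finset.sum_nonneg fun _ _ => sq_nonneg _)
  have cross_le : (T : ℝ)⁻¹ * ∑ j : Fin p, score x T e j * (b - β) j ≤ (T : ℝ)⁻¹ * (u * v) :=
    mul_le_mul_of_nonneg_left (sum_score_mul_le x T p e (b - β)) (by positivity)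
  have young : 2 * ((T : ℝ)⁻¹ * (u * v)) ≤ a * v ^ 2 / 2 + 2 * u ^ 2 / (a * T ^ 2) := by
    have gap : a * v ^ 2 / 2 + 2 * u ^ 2 / (a * T ^ 2) - 2 * ((T : ℝ)⁻¹ * (u * v))
        = (a / 2) * (v - 2 * u / (a * T)) ^ 2 := by field_simp; ring
    have : 0 ≤ (a / 2) * (v - 2 * u / (a * T)) ^ 2 := by positivity
    linarith
  have penalty_nonneg : 0 ≤ lam * lsNorm s b := mul_nonneg hlam (lsNorm_nonneg s b)
  have hscore : 4 * scoreSq x T p e / (a * T ^ 2) = 2 * (2 * u ^ 2 / (a * T ^ 2)) := by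
    rw [hu]; ring
  rw [← hv] at hG
  linarith [sampleMSPE_le_of_isMinOn h]

end BasicInequality

/-! ### Gram matrices -/

theorem sum_sq_mul_transpose_eq_trace {m n : Type*} [Fintype m] [Fintype n] (X : Matrix m n ℝ) :
    ∑ s, ∑ t, (X * Xᵀ) s t ^ 2 = ((Xᵀ * X) * (Xᵀ * X)).trace := by
  have hsymm : (X * Xᵀ)ᵀ = X * Xᵀ := by rw [Matrix.transpose_mul, Matrix.transpose_transpose]
  calc ∑ s, ∑ t, (X * Xᵀ) s t ^ 2 = ((X * Xᵀ) * (X * Xᵀ)ᵀ).trace := by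
        simp only [Matrix.trace, Matrix.diag, Matrix.mul_apply (M := X * Xᵀ),
          Matrix.transpose_apply (M := X * Xᵀ), sq]
    _ = ((Xᵀ * X) * (Xᵀ * X)).trace := by
        rw [hsymm, Matrix.mul_assoc, Matrix.trace_mul_comm, Matrix.mul_assoc, Matrix.mul_assoc,
          Matrix.mul_assoc]

section Spectrum

variable {n : Type*} [Fintype n] [DecidableEq n] {A : Matrix n n ℝ} {a b : ℝ}

theorem mul_dotProduct_self_le_of_le_spectrum (hA : A.IsHermitian)
    (h : ∀ κ ∈ spectrum ℝ A, a ≤ κ) (v : n → ℝ) : a * (v ⬝ᵥ v) ≤ v ⬝ᵥ A *ᵥ v := by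
  have hpos : (A - algebraMap ℝ _ a).PosSemidef := by
    rw [Matrix.posSemidef_iff_isHermitian_and_spectrum_nonneg]
    refine ⟨hA.sub (by simp [Matrix.IsHermitian, Matrix.algebraMap_eq_diagonal]), ?_⟩
    rw [← spectrum.sub_singleton_eq]
    rintro - ⟨κ, hκ, c, rfl, rfl⟩
    exact sub_nonneg.2 (h κ hκ)
  have hquad := hpos.dotProduct_mulVec_nonneg v
  rw [Matrix.sub_mulVec, dotProduct_sub, star_trivial, Algebra.algebraMap_eq_smul_one,
    Matrix.smul_mulVec, Matrix.one_mulVec, dotProduct_smul, smul_eq_mul] at hquad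
  linarith

theorem trace_mul_self_le_of_abs_spectrum_le (hA : A.IsHermitian)
    (h : ∀ κ ∈ spectrum ℝ A, |κ| ≤ b) : (A * A).trace ≤ Fintype.card n * b ^ 2 := by
  have trace_eq : (A * A).trace = ∑ i, hA.eigenvalues i ^ 2 := by
    conv_lhs => rw [hA.spectral_theorem, ← map_mul, Unitary.conjStarAlgAut_apply,
      Matrix.trace_mul_comm, ← Matrix.mul_assoc, Unitary.coe_star_mul_self, Matrix.one_mul,
      Matrix.diagonal_mul_diagonal, Matrix.trace_diagonal]
    simp [sq]
  calc (A * A).trace = ∑ i, hA.eigenvalues i ^ 2 := trace_eq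
    _ ≤ ∑ _i : n, b ^ 2 := Finset.sum_le_sum fun i _ =>
        sq_le_sq' (abs_le.1 (h _ (hA.eigenvalues_mem_spectrum_real i))).1
          (abs_le.1 (h _ (hA.eigenvalues_mem_spectrum_real i))).2
    _ = Fintype.card n * b ^ 2 := by simp

end Spectrum

theorem gramMatrix_isHermitian (x : ℕ → ℕ → ℝ) (T p : ℕ) : (gramMatrix x T p).IsHermitian := by
  rw [Matrix.IsHermitian, gramMatrix, Matrix.conjTranspose_smul, Matrix.conjTranspose_mul]
  simp [Matrix.conjTranspose_eq_transpose_of_trivial]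

theorem sampleMSPE_eq_dotProduct (x : ℕ → ℕ → ℝ) (T p : ℕ) (β b : Fin p → ℝ) :
    sampleMSPE x T p β b = (b - β) ⬝ᵥ (gramMatrix x T p *ᵥ (b - β)) := by
  rw [sampleMSPE_eq, gramMatrix, Matrix.smul_mulVec, dotProduct_smul, ← Matrix.mulVec_mulVec,
    Matrix.dotProduct_mulVec, Matrix.vecMul_transpose, smul_eq_mul]
  simp [dotProduct, sq]

theorem mul_sum_sq_le_sampleMSPE {x : ℕ → ℕ → ℝ} {T p : ℕ} {a : ℝ}
    (h : ∀ κ ∈ spectrum ℝ (gramMatrix x T p), a ≤ κ) (β b : Fin p → ℝ) :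
    a * ∑ j, (b - β) j ^ 2 ≤ sampleMSPE x T p β b := by
  rw [sampleMSPE_eq_dotProduct]
  simpa only [dotProduct, ← sq] using
    mul_dotProduct_self_le_of_le_spectrum (gramMatrix_isHermitian x T p) h (b - β)

theorem sum_sq_outerGram_le {x : ℕ → ℕ → ℝ} {T p : ℕ} {b : ℝ} (hT : 1 ≤ T)
    (h : ∀ κ ∈ spectrum ℝ (gramMatrix x T p), |κ| ≤ b) :
    ∑ s ∈ Finset.Icc 1 T, ∑ t ∈ Finset.Icc 1 T, (∑ j ∈ Finset.range p, x s j * x t j) ^ 2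
      ≤ (T : ℝ) ^ 2 * (p * b ^ 2) := by
  set X := designMatrix x T p with hX
  have frobenius_eq : ∑ s ∈ Finset.Icc 1 T, ∑ t ∈ Finset.Icc 1 T,
      (∑ j ∈ Finset.range p, x s j * x t j) ^ 2 = ∑ s, ∑ t, (X * Xᵀ) s t ^ 2 := by
    simp_rw [sum_Icc_one_eq_sum_fin, ← Fin.sum_univ_eq_sum_range (fun j => x _ j * x _ j),
      Matrix.mul_apply, hX, Matrix.transpose_apply, designMatrix]
  have gram_eq : Xᵀ * X = (T : ℝ) • gramMatrix x T p := by
    rw [gramMatrix, smul_smul, mul_inv_cancel₀ (by positivity), one_smul]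
  calc ∑ s ∈ Finset.Icc 1 T, ∑ t ∈ Finset.Icc 1 T, (∑ j ∈ Finset.range p, x s j * x t j) ^ 2
      = (T : ℝ) ^ 2 * (gramMatrix x T p * gramMatrix x T p).trace := by
        rw [frobenius_eq, sum_sq_mul_transpose_eq_trace, gram_eq]
        simp [sq, mul_assoc]
    _ ≤ (T : ℝ) ^ 2 * (p * b ^ 2) := by
        gcongr
        simpa using trace_mul_self_le_of_abs_spectrum_le (gramMatrix_isHermitian x T p) h

/-! ### Covariance inequalities -/

section Covariance

variable {Ω : Type*} {mΩ : MeasurableSpace Ω} {μ : Measure Ω}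

theorem covariance_sq_le [IsFiniteMeasure μ] {X Y : Ω → ℝ} (hX : MemLp X 2 μ) (hY : MemLp Y 2 μ) :
    cov[X, Y; μ] ^ 2 ≤ Var[X; μ] * Var[Y; μ] := by
  have hdiscrim : discrim (Var[Y; μ]) (2 * cov[X, Y; μ]) (Var[X; μ]) ≤ 0 :=
    discrim_le_zero fun c => by
      have hvar := variance_add hX (hY.const_smul c)
      rw [variance_smul, covariance_smul_right] at hvar
      linarith [variance_nonneg (X + c • Y) μ]
  rw [discrim] at hdiscrim
  linarith

theorem abs_covariance_le_of_variance_le [IsFiniteMeasure μ] {X Y : Ω → ℝ} (hX : MemLp X 2 μ)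
    (hY : MemLp Y 2 μ) {a b : ℝ} (ha : 0 ≤ a) (hb : 0 ≤ b) (hXa : Var[X; μ] ≤ a ^ 2)
    (hYb : Var[Y; μ] ≤ b ^ 2) : |cov[X, Y; μ]| ≤ a * b := by
  refine abs_le_of_sq_le_sq ?_ (mul_nonneg ha hb)
  calc cov[X, Y; μ] ^ 2 ≤ Var[X; μ] * Var[Y; μ] := covariance_sq_le hX hY
    _ ≤ a ^ 2 * b ^ 2 := mul_le_mul hXa hYb (variance_nonneg _ _) (sq_nonneg a)
    _ = (a * b) ^ 2 := (mul_pow a b 2).symm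

theorem variance_le_sq_of_abs_le [IsProbabilityMeasure μ] {X : Ω → ℝ} (hX : AEMeasurable X μ)
    {R : ℝ} (hR : ∀ ω, |X ω| ≤ R) : Var[X; μ] ≤ R ^ 2 := by
  refine (variance_le_sq_of_bounded (ae_of_all _ fun ω => Set.mem_Icc.2 (abs_le.1 (hR ω))) hX).trans
    (le_of_eq ?_)
  ring

end Covariance

/-! ### Quadratic forms of finitely dependent sequences -/

/-- The times `s` and `t` differ by at most `k`. -/
abbrev Near (k s t : ℕ) : Prop := s ≤ t + k ∧ t ≤ s + k

/-- The relation between pairs of times `P`, `Q` outside of which the products `e_{P.1} e_{P.2}` and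
`e_{Q.1} e_{Q.2}` of a centred `k`-dependent sequence are uncorrelated. Join times at distance at
most `k` by an edge: the products are uncorrelated if some time has no neighbour or if no edge joins
`P` to `Q`; otherwise the four times are matched across `P` and `Q` or connected, hence within `3 k`
of each other. -/
abbrev Linked (k : ℕ) (P Q : ℕ × ℕ) : Prop :=
  (Near k P.1 Q.1 ∧ Near k P.2 Q.2) ∨ (Near k P.1 Q.2 ∧ Near k P.2 Q.1) ∨
    (Near (3 * k) P.1 P.2 ∧ Near (3 * k) Q.1 Q.2 ∧ Near (3 * k) P.1 Q.1 ∧ Near (3 * k) P.2 Q.2)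

theorem Linked.symm {k : ℕ} {P Q : ℕ × ℕ} (h : Linked k P Q) : Linked k Q P := by
  simp only [Linked, Near] at *
  omega

theorem separated_or_isolated_of_not_linked {k s t u v : ℕ} (h : ¬ Linked k (s, t) (u, v)) :
    (¬ Near k s u ∧ ¬ Near k s v ∧ ¬ Near k t u ∧ ¬ Near k t v) ∨
    (¬ Near k s t ∧ ¬ Near k s u ∧ ¬ Near k s v) ∨
    (¬ Near k t s ∧ ¬ Near k t u ∧ ¬ Near k t v) ∨
    (¬ Near k u v ∧ ¬ Near k u s ∧ ¬ Near k u t) ∨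
    (¬ Near k v u ∧ ¬ Near k v s ∧ ¬ Near k v t) := by
  simp only [Linked, Near] at *
  omega

/-- The square of side `2 K + 1` centred at `P`, cut off at `0`. -/
abbrev box (K : ℕ) (P : ℕ × ℕ) : Finset (ℕ × ℕ) :=
  Finset.Icc (P.1 - K) (P.1 + K) ×ˢ Finset.Icc (P.2 - K) (P.2 + K)

theorem card_box_le (K : ℕ) (P : ℕ × ℕ) : (box K P).card ≤ (2 * K + 1) ^ 2 := by
  have hside : ∀ s : ℕ, (Finset.Icc (s - K) (s + K)).card ≤ 2 * K + 1 := fun s => by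
    rw [Nat.card_Icc]
    omega
  rw [Finset.card_product, pow_two]
  exact Nat.mul_le_mul (hside P.1) (hside P.2)

theorem card_filter_linked_le (k : ℕ) (S : Finset (ℕ × ℕ)) (P : ℕ × ℕ) :
    ({Q ∈ S | Linked k P Q}).card
      ≤ 2 * (2 * k + 1) ^ 2 + if Near (3 * k) P.1 P.2 then (6 * k + 1) ^ 2 else 0 := by
  have hsub : {Q ∈ S | Linked k P Q}
      ⊆ box k P ∪ box k P.swap ∪ if Near (3 * k) P.1 P.2 then box (3 * k) P else ∅ := by
    intro Q hQ
    rcases (Finset.mem_filter.1 hQ).2 with h | h | h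
    · simp only [Near, Finset.mem_union, Finset.mem_product, Finset.mem_Icc] at h ⊢
      omega
    · simp only [Near, Prod.swap, Finset.mem_union, Finset.mem_product, Finset.mem_Icc] at h ⊢
      omega
    · rw [if_pos h.1]
      simp only [Near, Finset.mem_union, Finset.mem_product, Finset.mem_Icc] at h ⊢
      omega
  refine (Finset.card_le_card hsub).trans ((Finset.card_union_le _ _).trans (add_le_add ?_ ?_))
  · refine (Finset.card_union_le _ _).trans ?_
    linarith [card_box_le k P, card_box_le k P.swap]
  · split_ifs
    · refine (card_box_le (3 * k) P).trans_eq ?_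
      ring
    · simp

theorem sum_sum_filter_mul_le {ι : Type*} (S : Finset ι) (r : ι → ι → Prop) [DecidableRel r]
    (hsymm : ∀ i j, r i j → r j i) (a : ι → ℝ) :
    ∑ i ∈ S, ∑ j ∈ S with r i j, |a i| * |a j| ≤ ∑ i ∈ S, ({j ∈ S | r i j}).card * a i ^ 2 := by
  have hswap : ∑ i ∈ S, ∑ j ∈ S with r i j, a j ^ 2 = ∑ i ∈ S, ∑ j ∈ S with r i j, a i ^ 2 := by
    simp_rw [Finset.sum_filter]
    rw [Finset.sum_comm]
    refine Finset.sum_congr rfl fun i _ => Finset.sum_congr rfl fun j _ => ?_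
    rw [if_congr ⟨hsymm j i, hsymm i j⟩ rfl rfl]
  have hyoung : ∑ i ∈ S, ∑ j ∈ S with r i j, |a i| * |a j|
      ≤ ∑ i ∈ S, ∑ j ∈ S with r i j, (a i ^ 2 + a j ^ 2) / 2 :=
    Finset.sum_le_sum fun i _ => Finset.sum_le_sum fun j _ => by
      nlinarith [sq_nonneg (|a i| - |a j|), sq_abs (a i), sq_abs (a j)]
  simp_rw [← Finset.sum_div, Finset.sum_add_distrib] at hyoung
  rw [hswap] at hyoung
  simp only [Finset.sum_const, nsmul_eq_mul] at hyoung
  linarith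

theorem sum_near_sq_le (K : ℕ) (S : Finset ℕ) {a : ℕ → ℕ → ℝ} {b : ℝ} (hb : ∀ s t, |a s t| ≤ b) :
    ∑ s ∈ S, ∑ t ∈ S with Near K s t, a s t ^ 2 ≤ S.card * ((2 * K + 1) * b ^ 2) := by
  have hcard : ∀ s, ({t ∈ S | Near K s t}).card ≤ 2 * K + 1 := fun s => by
    refine (Finset.card_le_card (t := Finset.Icc (s - K) (s + K)) fun t ht => ?_).trans ?_
    · rw [Finset.mem_filter, Near] at ht
      rw [Finset.mem_Icc]
      omega
    · rw [Nat.card_Icc]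
      omega
  rw [← nsmul_eq_mul]
  refine Finset.sum_le_card_nsmul _ _ _ fun s _ => ?_
  calc ∑ t ∈ S with Near K s t, a s t ^ 2 ≤ ({t ∈ S | Near K s t}).card • b ^ 2 :=
        Finset.sum_le_card_nsmul _ _ _ fun t _ => sq_le_sq' (abs_le.1 (hb s t)).1
          (abs_le.1 (hb s t)).2
    _ ≤ (2 * K + 1) * b ^ 2 := by
        rw [nsmul_eq_mul]
        gcongr
        exact_mod_cast hcard s

section FinitelyDependent

variable {Ω : Type*} {mΩ : MeasurableSpace Ω} {μ : Measure Ω} {e : ℕ → Ω → ℝ} {k : ℕ} {R : ℝ}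

/-- The sequence `e` is `k`-dependent: finite subfamilies whose times are more than `k` apart are
independent. -/
def KDependent (μ : Measure Ω) (k : ℕ) (e : ℕ → Ω → ℝ) : Prop :=
  ∀ A B : Finset ℕ, (∀ a ∈ A, ∀ b ∈ B, ¬ Near k a b) →
    IndepFun (fun ω (a : A) => e a ω) (fun ω (b : B) => e b ω) μ

theorem KDependent.integral_mul_eq_zero (hk : KDependent μ k e) (he : ∀ t, Measurable (e t)) {s : ℕ}
    (hs : ∫ ω, e s ω ∂μ = 0) {B : Finset ℕ} (hB : ∀ b ∈ B, ¬ Near k s b) {g : (B → ℝ) → ℝ}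
    (hg : Measurable g) : ∫ ω, e s ω * g (fun b => e b ω) ∂μ = 0 := by
  have hindep := (hk {s} B (by simpa using hB)).comp
    (measurable_pi_apply (⟨s, Finset.mem_singleton_self s⟩ : ({s} : Finset ℕ))) hg
  have hmeas : Measurable fun ω => g fun b => e b ω :=
    hg.comp (measurable_pi_lambda _ fun b => he b)
  have hfactor := hindep.integral_fun_mul_eq_mul_integral (he s).aestronglyMeasurable
    hmeas.aestronglyMeasurable
  simpa [Function.comp_def, hs] using hfactor

/-- A bounded centred measurable sequence. -/
structure IsBoundedCentred (μ : Measure Ω) (R : ℝ) (e : ℕ → Ω → ℝ) : Prop where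
  measurable : ∀ t, Measurable (e t)
  abs_le : ∀ t ω, |e t ω| ≤ R
  integral_eq_zero : ∀ t, ∫ ω, e t ω ∂μ = 0

namespace IsBoundedCentred

theorem abs_mul_le (he : IsBoundedCentred μ R e) (s t : ℕ) (ω : Ω) : |e s ω * e t ω| ≤ R ^ 2 := by
  rw [abs_mul, pow_two]
  exact mul_le_mul (he.abs_le s ω) (he.abs_le t ω) (abs_nonneg _)
    ((abs_nonneg _).trans (he.abs_le s ω))

variable [IsProbabilityMeasure μ]

theorem memLp_mul (he : IsBoundedCentred μ R e) (s t : ℕ) : MemLp (fun ω => e s ω * e t ω) 2 μ :=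
  MemLp.of_bound ((he.measurable s).mul (he.measurable t)).aestronglyMeasurable (R ^ 2)
    (ae_of_all _ fun ω => he.abs_mul_le s t ω)

theorem covariance_mul_mul_eq_zero_of_isolated (he : IsBoundedCentred μ R e)
    (hk : KDependent μ k e) {s t u v : ℕ} (ht : ¬ Near k s t) (hu : ¬ Near k s u)
    (hv : ¬ Near k s v) : cov[fun ω => e s ω * e t ω, fun ω => e u ω * e v ω; μ] = 0 := by
  have hB : ∀ b ∈ ({t, u, v} : Finset ℕ), ¬ Near k s b := by
    simp only [Finset.mem_insert, Finset.mem_singleton]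
    rintro b (rfl | rfl | rfl) <;> assumption
  let t' : ({t, u, v} : Finset ℕ) := ⟨t, by simp⟩
  let u' : ({t, u, v} : Finset ℕ) := ⟨u, by simp⟩
  let v' : ({t, u, v} : Finset ℕ) := ⟨v, by simp⟩
  have hpair : ∫ ω, e s ω * e t ω ∂μ = 0 :=
    hk.integral_mul_eq_zero he.measurable (he.integral_eq_zero s) hB
      (g := fun y => y t') (by fun_prop)
  have hquad : ∫ ω, e s ω * (e t ω * (e u ω * e v ω)) ∂μ = 0 :=
    hk.integral_mul_eq_zero he.measurable (he.integral_eq_zero s) hB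
      (g := fun y => y t' * (y u' * y v')) (by fun_prop)
  rw [covariance_eq_sub (he.memLp_mul s t) (he.memLp_mul u v), hpair, zero_mul, sub_zero, ← hquad]
  simp only [Pi.mul_apply, mul_assoc]

theorem covariance_mul_mul_eq_zero_of_separated (he : IsBoundedCentred μ R e)
    (hk : KDependent μ k e) {s t u v : ℕ} (hsu : ¬ Near k s u) (hsv : ¬ Near k s v)
    (htu : ¬ Near k t u) (htv : ¬ Near k t v) :
    cov[fun ω => e s ω * e t ω, fun ω => e u ω * e v ω; μ] = 0 := by
  have hindep := hk {s, t} {u, v} (by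
    simp only [Finset.mem_insert, Finset.mem_singleton]
    rintro a (rfl | rfl) b (rfl | rfl) <;> assumption)
  let s' : ({s, t} : Finset ℕ) := ⟨s, by simp⟩
  let t' : ({s, t} : Finset ℕ) := ⟨t, by simp⟩
  let u' : ({u, v} : Finset ℕ) := ⟨u, by simp⟩
  let v' : ({u, v} : Finset ℕ) := ⟨v, by simp⟩
  have hprod := hindep.comp (φ := fun y => y s' * y t') (ψ := fun y => y u' * y v') (by fun_prop)
    (by fun_prop)
  exact hprod.covariance_eq_zero (he.memLp_mul s t) (he.memLp_mul u v)

theorem covariance_mul_mul_eq_zero_of_not_linked (he : IsBoundedCentred μ R e)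
    (hk : KDependent μ k e) {s t u v : ℕ} (h : ¬ Linked k (s, t) (u, v)) :
    cov[fun ω => e s ω * e t ω, fun ω => e u ω * e v ω; μ] = 0 := by
  have swap : ∀ a b, (fun ω => e a ω * e b ω) = fun ω => e b ω * e a ω := fun a b =>
    funext fun ω => mul_comm _ _
  rcases separated_or_isolated_of_not_linked h with
    ⟨hsu, hsv, htu, htv⟩ | ⟨h₁, h₂, h₃⟩ | ⟨h₁, h₂, h₃⟩ | ⟨h₁, h₂, h₃⟩ | ⟨h₁, h₂, h₃⟩
  · exact he.covariance_mul_mul_eq_zero_of_separated hk hsu hsv htu htv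
  · exact he.covariance_mul_mul_eq_zero_of_isolated hk h₁ h₂ h₃
  · rw [swap s t]
    exact he.covariance_mul_mul_eq_zero_of_isolated hk h₁ h₂ h₃
  · rw [covariance_comm]
    exact he.covariance_mul_mul_eq_zero_of_isolated hk h₁ h₂ h₃
  · rw [covariance_comm, swap u v]
    exact he.covariance_mul_mul_eq_zero_of_isolated hk h₁ h₂ h₃

theorem abs_covariance_mul_mul_le (he : IsBoundedCentred μ R e) (s t u v : ℕ) :
    |cov[fun ω => e s ω * e t ω, fun ω => e u ω * e v ω; μ]| ≤ R ^ 4 := by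
  have hvar : ∀ s t, Var[fun ω => e s ω * e t ω; μ] ≤ (R ^ 2) ^ 2 := fun s t =>
    variance_le_sq_of_abs_le (he.memLp_mul s t).aestronglyMeasurable.aemeasurable
      (he.abs_mul_le s t)
  refine (abs_covariance_le_of_variance_le (he.memLp_mul s t) (he.memLp_mul u v) (sq_nonneg R)
    (sq_nonneg R) (hvar s t) (hvar u v)).trans_eq ?_
  ring

theorem variance_quadForm_le_sum_linked (he : IsBoundedCentred μ R e) (hk : KDependent μ k e)
    (S : Finset (ℕ × ℕ)) (a : ℕ × ℕ → ℝ) :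
    Var[fun ω => ∑ P ∈ S, a P * (e P.1 ω * e P.2 ω); μ]
      ≤ R ^ 4 * ∑ P ∈ S, ∑ Q ∈ S with Linked k P Q, |a P| * |a Q| := by
  rw [variance_fun_sum' fun P _ => (he.memLp_mul P.1 P.2).const_mul (a P), Finset.mul_sum]
  refine Finset.sum_le_sum fun P _ => ?_
  rw [Finset.sum_filter, Finset.mul_sum]
  refine Finset.sum_le_sum fun Q _ => ?_
  rw [covariance_const_mul_left, covariance_const_mul_right]
  split_ifs with h
  · calc a P * (a Q * cov[fun ω => e P.1 ω * e P.2 ω, fun ω => e Q.1 ω * e Q.2 ω; μ])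
        ≤ |a P| * (|a Q| * |cov[fun ω => e P.1 ω * e P.2 ω, fun ω => e Q.1 ω * e Q.2 ω; μ]|) := by
          rw [← abs_mul, ← abs_mul]
          exact le_abs_self _
      _ ≤ |a P| * (|a Q| * R ^ 4) := by
          gcongr
          exact he.abs_covariance_mul_mul_le P.1 P.2 Q.1 Q.2
      _ = R ^ 4 * (|a P| * |a Q|) := by ring
  · rw [he.covariance_mul_mul_eq_zero_of_not_linked hk h]
    simp

theorem variance_quadForm_le (he : IsBoundedCentred μ R e) (hk : KDependent μ k e) (S : Finset ℕ)
    {a : ℕ → ℕ → ℝ} {b : ℝ} (hb : ∀ s t, |a s t| ≤ b) :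
    Var[fun ω => ∑ P ∈ S ×ˢ S, a P.1 P.2 * (e P.1 ω * e P.2 ω); μ]
      ≤ R ^ 4 * (2 * (2 * k + 1) ^ 2 * ∑ s ∈ S, ∑ t ∈ S, a s t ^ 2
        + (6 * k + 1) ^ 2 * (S.card * ((6 * k + 1) * b ^ 2))) := by
  have hnear : ∑ P ∈ S ×ˢ S with Near (3 * k) P.1 P.2, a P.1 P.2 ^ 2
      ≤ S.card * ((6 * k + 1) * b ^ 2) := by
    rw [Finset.sum_filter, Finset.sum_product]
    simp_rw [← Finset.sum_filter]
    refine (sum_near_sq_le (3 * k) S hb).trans_eq ?_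
    push_cast
    ring
  refine (he.variance_quadForm_le_sum_linked hk _ fun P => a P.1 P.2).trans ?_
  gcongr
  calc ∑ P ∈ S ×ˢ S, ∑ Q ∈ S ×ˢ S with Linked k P Q, |a P.1 P.2| * |a Q.1 Q.2|
      ≤ ∑ P ∈ S ×ˢ S, ({Q ∈ S ×ˢ S | Linked k P Q}).card * a P.1 P.2 ^ 2 :=
        sum_sum_filter_mul_le _ (Linked k) (fun _ _ => Linked.symm) fun P => a P.1 P.2
    _ ≤ ∑ P ∈ S ×ˢ S, (2 * (2 * k + 1) ^ 2
          + if Near (3 * k) P.1 P.2 then ((6 * k + 1) ^ 2 : ℝ) else 0) * a P.1 P.2 ^ 2 := by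
        gcongr with P
        exact_mod_cast card_filter_linked_le k (S ×ˢ S) P
    _ = 2 * (2 * k + 1) ^ 2 * ∑ s ∈ S, ∑ t ∈ S, a s t ^ 2
          + (6 * k + 1) ^ 2 * ∑ P ∈ S ×ˢ S with Near (3 * k) P.1 P.2, a P.1 P.2 ^ 2 := by
        simp_rw [add_mul, Finset.sum_add_distrib, ite_mul, zero_mul, ← Finset.sum_filter,
          ← Finset.mul_sum, Finset.sum_product]
    _ ≤ _ := by gcongr

end IsBoundedCentred

end FinitelyDependent

/-! ### Causal Lipschitz functionals and their truncations -/

theorem sum_one_div_sq_le_two (n : ℕ) :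
    ∑ h ∈ Finset.range n, 1 / ((h : ℝ) + 1) ^ 2 ≤ 2 := by
  have hshift := sum_Ioo_inv_sq_le (α := ℝ) 0 (n + 1)
  rw [show Finset.Ioo 0 (n + 1) = Finset.Ico 1 (n + 1) from rfl, Finset.sum_Ico_eq_sum_range]
    at hshift
  simpa [add_comm] using hshift

/-- The weight of the observation of lag `h`. It decays like the coefficients `j ^ (-7/2 - θ)`,
`θ ≥ 3/2`, of the linear processes, with one power to spare. -/
noncomputable def lagWeight (h : ℕ) : ℝ := 1 / ((h : ℝ) + 1) ^ 4

theorem lagWeight_nonneg (h : ℕ) : 0 ≤ lagWeight h := by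
  unfold lagWeight
  positivity

theorem sum_lagWeight_tail_le (n a : ℕ) :
    ∑ h ∈ Finset.range n with a ≤ h, lagWeight h ≤ 2 / ((a : ℝ) + 1) ^ 2 := by
  calc ∑ h ∈ Finset.range n with a ≤ h, lagWeight h
      ≤ ∑ h ∈ Finset.range n with a ≤ h, 1 / ((a : ℝ) + 1) ^ 2 * (1 / ((h : ℝ) + 1) ^ 2) := by
        refine Finset.sum_le_sum fun h hh => ?_
        rw [lagWeight, one_div_mul_one_div, show ((h : ℝ) + 1) ^ 4 =
          ((h : ℝ) + 1) ^ 2 * ((h : ℝ) + 1) ^ 2 by ring]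
        gcongr
        exact (Finset.mem_filter.1 hh).2
    _ ≤ ∑ h ∈ Finset.range n, 1 / ((a : ℝ) + 1) ^ 2 * (1 / ((h : ℝ) + 1) ^ 2) :=
        Finset.sum_le_sum_of_subset_of_nonneg (Finset.filter_subset _ _) fun _ _ _ => by positivity
    _ ≤ 1 / ((a : ℝ) + 1) ^ 2 * 2 := by
        rw [← Finset.mul_sum]
        gcongr
        exact sum_one_div_sq_le_two n
    _ = 2 / ((a : ℝ) + 1) ^ 2 := by ring

theorem sum_lagWeight_le (n : ℕ) : ∑ h ∈ Finset.range n, lagWeight h ≤ 2 := by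
  simpa using sum_lagWeight_tail_le n 0

theorem sum_lagWeight_mul_ite_le (n a : ℕ) {δ : ℝ} (hδ : 0 ≤ δ) :
    ∑ h ∈ Finset.range n, lagWeight h * (if h < a then δ else 1)
      ≤ 2 * δ + 2 / ((a : ℝ) + 1) ^ 2 := by
  calc ∑ h ∈ Finset.range n, lagWeight h * (if h < a then δ else 1)
      ≤ ∑ h ∈ Finset.range n, (lagWeight h * δ + if a ≤ h then lagWeight h else 0) :=
        Finset.sum_le_sum fun h _ => by
          rcases lt_or_ge h a with hha | hha
          · simp [hha, hha.not_ge]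
          · simp [hha, hha.not_gt, mul_nonneg (lagWeight_nonneg h) hδ]
    _ = (∑ h ∈ Finset.range n, lagWeight h) * δ
          + ∑ h ∈ Finset.range n with a ≤ h, lagWeight h := by
        rw [Finset.sum_add_distrib, Finset.sum_mul, Finset.sum_filter]
    _ ≤ 2 * δ + 2 / ((a : ℝ) + 1) ^ 2 :=
        add_le_add (mul_le_mul_of_nonneg_right (sum_lagWeight_le n) hδ) (sum_lagWeight_tail_le n a)

theorem summable_lagWeight : Summable lagWeight :=
  summable_of_sum_range_le lagWeight_nonneg sum_lagWeight_le

theorem tsum_lagWeight_le : ∑' h, lagWeight h ≤ 2 :=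
  Real.tsum_le_of_sum_range_le lagWeight_nonneg sum_lagWeight_le

section Clip

variable {E : Type*} [NormedAddCommGroup E]

/-- The hard truncation of a vector at the level `R`: longer vectors are replaced by `0`. -/
noncomputable def clip (R : ℝ) (v : E) : E := (Metric.closedBall 0 R).indicator id v

theorem clip_of_norm_le {R : ℝ} {v : E} (h : ‖v‖ ≤ R) : clip R v = v :=
  Set.indicator_of_mem (mem_closedBall_zero_iff.2 h) id

theorem clip_of_lt_norm {R : ℝ} {v : E} (h : R < ‖v‖) : clip R v = 0 :=
  Set.indicator_of_notMem (by simpa using h) id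

theorem norm_clip_le {R : ℝ} (hR : 0 ≤ R) (v : E) : ‖clip R v‖ ≤ R := by
  rcases le_or_gt ‖v‖ R with h | h
  · rwa [clip_of_norm_le h]
  · rwa [clip_of_lt_norm h, norm_zero]

theorem norm_clip_le_norm (R : ℝ) (v : E) : ‖clip R v‖ ≤ ‖v‖ :=
  norm_indicator_le_norm_self id v

theorem norm_clip_sub_self_le (R : ℝ) (v : E) : ‖clip R v - v‖ ≤ ‖v‖ := by
  rcases le_or_gt ‖v‖ R with h | h
  · simp [clip_of_norm_le h]
  · simp [clip_of_lt_norm h]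

theorem norm_clip_sub_clip_le {R R' : ℝ} (hR : 0 < R) (hRR' : R ≤ R') (v : E) :
    ‖clip R' v - clip R v‖ ≤ 1 / R * ‖v‖ ^ 2 := by
  rcases le_or_gt ‖v‖ R with h | h
  · rw [clip_of_norm_le h, clip_of_norm_le (h.trans hRR'), sub_self, norm_zero]
    positivity
  · rw [clip_of_lt_norm h, sub_zero, one_div_mul_eq_div, le_div_iff₀ hR, pow_two]
    exact mul_le_mul (norm_clip_le_norm R' v) h.le hR.le (norm_nonneg v)

theorem measurable_clip [MeasurableSpace E] [OpensMeasurableSpace E] (R : ℝ) :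
    Measurable (clip R : E → E) :=
  measurable_id.indicator Metric.isClosed_closedBall.measurableSet

end Clip

section Causal

variable {E : Type*} [NormedAddCommGroup E]

/-- The part of `y` before the time `t` is summable against the lag weights. -/
def HasSummablePast (t : ℤ) (y : ℤ → E) : Prop :=
  Summable fun h : ℕ => lagWeight h * ‖y (t - h)‖

theorem hasSummablePast_of_eq_zero {s t : ℤ} {y : ℤ → E} (hy : ∀ τ ≤ s, y τ = 0) :
    HasSummablePast t y :=
  summable_of_ne_finset_zero (s := Finset.range (t - s).toNat) fun h hh => by
    rw [Finset.mem_range, not_lt] at hh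
    rw [hy _ (by omega), norm_zero, mul_zero]

/-- The functionals `G t` of a sequence of vectors depend on its values up to the time `t` only,
in a Lipschitz manner with polynomially decaying weights. -/
structure IsCausalLipschitz (c : ℝ) (G : ℤ → (ℤ → E) → ℝ) : Prop where
  nonneg : 0 ≤ c
  abs_sub_le : ∀ t y y', HasSummablePast t y → HasSummablePast t y' →
    |G t y - G t y'| ≤ c * ∑' h : ℕ, lagWeight h * ‖y (t - h) - y' (t - h)‖

/-- The sequence `y` with its values outside of `(s, t]` set to `0` and the others clipped at the
level `k + 1`, which makes a functional of it bounded. -/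
noncomputable def truncPast (k : ℕ) (s t : ℤ) (y : ℤ → E) : ℤ → E :=
  (Set.Ioc s t).indicator fun τ => clip (k + 1) (y τ)

theorem truncPast_eq_extend (k : ℕ) (s t : ℤ) (y : ℤ → E) :
    truncPast k s t y
      = Function.extend Subtype.val (fun τ : Set.Ioc s t => clip (k + 1) (y τ)) 0 := by
  funext τ
  by_cases hτ : τ ∈ Set.Ioc s t
  · rw [truncPast, Set.indicator_of_mem hτ]
    exact (Subtype.val_injective.extend_apply (fun τ : Set.Ioc s t => clip (k + 1) (y τ)) 0
      ⟨τ, hτ⟩).symm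
  · rw [truncPast, Set.indicator_of_notMem hτ,
      Function.extend_apply' _ _ _ fun ⟨τ', h⟩ => hτ (h ▸ τ'.2), Pi.zero_apply]

theorem truncPast_of_mem (k : ℕ) {s t τ : ℤ} (hτ : τ ∈ Set.Ioc s t) (y : ℤ → E) :
    truncPast k s t y τ = clip (k + 1) (y τ) :=
  Set.indicator_of_mem hτ _

theorem truncPast_of_le (k : ℕ) {s τ : ℤ} (hτ : τ ≤ s) (t : ℤ) (y : ℤ → E) :
    truncPast k s t y τ = 0 :=
  Set.indicator_of_notMem (fun h => hτ.not_gt h.1) _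

theorem hasSummablePast_truncPast (k : ℕ) (s t : ℤ) (y : ℤ → E) :
    HasSummablePast t (truncPast k s t y) :=
  hasSummablePast_of_eq_zero fun _ hτ => truncPast_of_le k hτ t y

theorem norm_truncPast_le (k : ℕ) (s t : ℤ) (y : ℤ → E) (τ : ℤ) :
    ‖truncPast k s t y τ‖ ≤ k + 1 :=
  (norm_indicator_le_norm_self _ τ).trans (norm_clip_le (by positivity) _)

theorem norm_truncPast_le_norm (k : ℕ) (s t : ℤ) (y : ℤ → E) (τ : ℤ) :
    ‖truncPast k s t y τ‖ ≤ ‖y τ‖ :=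
  (norm_indicator_le_norm_self _ τ).trans (norm_clip_le_norm _ _)

theorem norm_truncPast_sub_self_le (k : ℕ) (s t : ℤ) (y : ℤ → E) (τ : ℤ) :
    ‖truncPast k s t y τ - y τ‖ ≤ ‖y τ‖ := by
  by_cases hτ : τ ∈ Set.Ioc s t
  · rw [truncPast_of_mem k hτ]
    exact norm_clip_sub_self_le _ _
  · simp [truncPast, hτ]

theorem tendsto_truncPast (t : ℤ) (y : ℤ → E) {τ : ℤ} (hτ : τ ≤ t) :
    Tendsto (fun k : ℕ => truncPast k (t - k) t y τ) atTop (𝓝 (y τ)) := by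
  obtain ⟨n, hn⟩ := exists_nat_ge ‖y τ‖
  refine tendsto_const_nhds.congr' ?_
  filter_upwards [eventually_ge_atTop n, eventually_gt_atTop (t - τ).toNat] with k hkn hkτ
  have hnk : (n : ℝ) ≤ k := by exact_mod_cast hkn
  rw [truncPast_of_mem k ⟨by omega, hτ⟩, clip_of_norm_le (by linarith)]

namespace IsCausalLipschitz

variable {c : ℝ} {G : ℤ → (ℤ → E) → ℝ}

theorem abs_sub_le_tsum (hG : IsCausalLipschitz c G) {t : ℤ} {y y' : ℤ → E}
    (hy : HasSummablePast t y) (hy' : HasSummablePast t y') {b : ℕ → ℝ}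
    (hb : Summable fun h => lagWeight h * b h) (hle : ∀ h : ℕ, ‖y (t - h) - y' (t - h)‖ ≤ b h) :
    |G t y - G t y'| ≤ c * ∑' h, lagWeight h * b h := by
  refine (hG.abs_sub_le t y y' hy hy').trans (mul_le_mul_of_nonneg_left ?_ hG.nonneg)
  have hmul : ∀ h : ℕ, lagWeight h * ‖y (t - h) - y' (t - h)‖ ≤ lagWeight h * b h := fun h =>
    mul_le_mul_of_nonneg_left (hle h) (lagWeight_nonneg h)
  exact (hb.of_nonneg_of_le (fun h => mul_nonneg (lagWeight_nonneg h) (norm_nonneg _))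
    hmul).tsum_le_tsum hmul hb

theorem abs_sub_le_of_norm_sub_le (hG : IsCausalLipschitz c G) {t : ℤ} {y y' : ℤ → E}
    (hy : HasSummablePast t y) (hy' : HasSummablePast t y') {R : ℝ} (hR : 0 ≤ R)
    (hle : ∀ τ, ‖y τ - y' τ‖ ≤ R) : |G t y - G t y'| ≤ 2 * c * R := by
  refine (hG.abs_sub_le_tsum hy hy' (summable_lagWeight.mul_right R) fun h => hle _).trans ?_
  rw [tsum_mul_right]
  nlinarith [mul_le_mul_of_nonneg_left tsum_lagWeight_le (mul_nonneg hG.nonneg hR)]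

theorem abs_sub_le_sum (hG : IsCausalLipschitz c G) {t : ℤ} {y y' : ℤ → E}
    (hy : HasSummablePast t y) (hy' : HasSummablePast t y') {n : ℕ} {b : ℕ → ℝ}
    (heq : ∀ h : ℕ, n ≤ h → y (t - h) = y' (t - h))
    (hle : ∀ h < n, ‖y (t - h) - y' (t - h)‖ ≤ b h) :
    |G t y - G t y'| ≤ ∑ h ∈ Finset.range n, c * (lagWeight h * b h) := by
  rw [← Finset.mul_sum]
  refine (hG.abs_sub_le t y y' hy hy').trans (mul_le_mul_of_nonneg_left ?_ hG.nonneg)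
  rw [tsum_eq_sum (s := Finset.range n) fun h hh => by
    rw [heq h (by simpa using hh), sub_self, norm_zero, mul_zero]]
  exact Finset.sum_le_sum fun h hh =>
    mul_le_mul_of_nonneg_left (hle h (Finset.mem_range.1 hh)) (lagWeight_nonneg h)

end IsCausalLipschitz

variable {Ω : Type*}

/-- The functional `G` at the time `t` of the process `Y` clipped at the level `k + 1` and set to
`0` outside of `(s, t]`. -/
noncomputable def truncEval (G : ℤ → (ℤ → E) → ℝ) (Y : ℤ → Ω → E) (k : ℕ) (s t : ℤ) (ω : Ω) : ℝ :=
  G t (truncPast k s t fun τ => Y τ ω)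

/-- The bounded approximation of order `k` of the process `ω ↦ G t (fun τ => Y τ ω)`, a functional
of its `k` most recent innovations. -/
noncomputable def truncApprox (G : ℤ → (ℤ → E) → ℝ) (Y : ℤ → Ω → E) (k : ℕ) (t : ℤ) : Ω → ℝ :=
  truncEval G Y k (t - k) t

/-- The σ-algebra generated by the values of the process `Y` at the times in `I`. -/
abbrev timeField [MeasurableSpace E] (Y : ℤ → Ω → E) (I : Set ℤ) : MeasurableSpace Ω :=
  ⨆ τ ∈ I, MeasurableSpace.comap (Y τ) inferInstance

namespace IsCausalLipschitz

variable {c : ℝ} {G : ℤ → (ℤ → E) → ℝ}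

theorem abs_truncEval_sub_le (hG : IsCausalLipschitz c G) (Y : ℤ → Ω → E) (k : ℕ) (s t : ℤ)
    (ω : Ω) : |truncEval G Y k s t ω - G t 0| ≤ 2 * c * (k + 1) :=
  hG.abs_sub_le_of_norm_sub_le (hasSummablePast_truncPast k s t _)
    (hasSummablePast_of_eq_zero (s := s) fun _ _ => rfl) (by positivity) fun τ => by
    simpa using norm_truncPast_le k s t (fun τ => Y τ ω) τ

theorem continuous_extend_zero (hG : IsCausalLipschitz c G) (s t : ℤ) :
    Continuous fun z : Set.Ioc s t → E => G t (Function.extend Subtype.val z 0) := by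
  have hpast : ∀ z : Set.Ioc s t → E, HasSummablePast t (Function.extend Subtype.val z 0) :=
    fun z => hasSummablePast_of_eq_zero fun τ hτ =>
      Function.extend_apply' _ _ _ fun ⟨τ', h⟩ => (h ▸ hτ).not_gt τ'.2.1
  refine (LipschitzWith.of_dist_le_mul (K := (2 * c).toNNReal) fun z z' => ?_).continuous
  rw [Real.coe_toNNReal _ (mul_nonneg zero_le_two hG.nonneg)]
  refine hG.abs_sub_le_of_norm_sub_le (hpast z) (hpast z') dist_nonneg fun τ => ?_
  by_cases hτ : τ ∈ Set.Ioc s t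
  · have hval : ∀ z : Set.Ioc s t → E, Function.extend Subtype.val z 0 τ = z ⟨τ, hτ⟩ := fun z =>
      Subtype.val_injective.extend_apply z 0 ⟨τ, hτ⟩
    rw [hval, hval, ← dist_eq_norm]
    exact dist_le_pi_dist z z' _
  · have hval : ∀ z : Set.Ioc s t → E, Function.extend Subtype.val z 0 τ = 0 := fun z =>
      Function.extend_apply' _ _ _ fun ⟨τ', h⟩ => hτ (h ▸ τ'.2)
    simp [hval]

theorem measurable_truncEval [MeasurableSpace E] [BorelSpace E] [SecondCountableTopology E]
    (hG : IsCausalLipschitz c G) (Y : ℤ → Ω → E) (k : ℕ) (s t : ℤ) :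
    Measurable[timeField Y (Set.Ioc s t)] (truncEval G Y k s t) := by
  have heq : truncEval G Y k s t = (fun z : Set.Ioc s t → E =>
      G t (Function.extend Subtype.val z 0)) ∘ fun ω τ => clip (k + 1) (Y τ ω) :=
    funext fun ω => congrArg (G t) (truncPast_eq_extend k s t fun τ => Y τ ω)
  rw [heq]
  let _ : MeasurableSpace Ω := timeField Y (Set.Ioc s t)
  refine (hG.continuous_extend_zero s t).measurable.comp (measurable_pi_iff.2 fun τ => ?_)
  exact (measurable_clip _).comp
    ((comap_measurable (Y τ)).mono (le_iSup₂_of_le τ.1 τ.2 le_rfl) le_rfl)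

end IsCausalLipschitz

end Causal

/-! ### Second moments of causal processes -/

section Moments

variable {Ω : Type*} {mΩ : MeasurableSpace Ω} {μ : Measure Ω}

theorem integral_sq_le_of_abs_le_sum {ι : Type*} {I : Finset ι} {b : ι → ℝ} {V : ι → Ω → ℝ}
    {X : Ω → ℝ} {K : ℝ} (hb : ∀ i ∈ I, 0 ≤ b i) (hV : ∀ i, Integrable (fun ω => V i ω ^ 2) μ)
    (hK : ∀ i, ∫ ω, V i ω ^ 2 ∂μ ≤ K) (hX : ∀ ω, |X ω| ≤ ∑ i ∈ I, b i * V i ω) :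
    ∫ ω, X ω ^ 2 ∂μ ≤ (∑ i ∈ I, b i) ^ 2 * K := by
  have hcauchy : ∀ ω, X ω ^ 2 ≤ (∑ i ∈ I, b i) * ∑ i ∈ I, b i * V i ω ^ 2 := fun ω =>
    calc X ω ^ 2 ≤ (∑ i ∈ I, b i * V i ω) ^ 2 := sq_le_sq' (abs_le.1 (hX ω)).1 (abs_le.1 (hX ω)).2
      _ ≤ _ := Finset.sum_sq_le_sum_mul_sum_of_sq_le_mul I hb
          (fun i hi => mul_nonneg (hb i hi) (sq_nonneg _)) fun i _ => le_of_eq (by ring)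
  calc ∫ ω, X ω ^ 2 ∂μ ≤ ∫ ω, (∑ i ∈ I, b i) * ∑ i ∈ I, b i * V i ω ^ 2 ∂μ :=
        integral_mono_of_nonneg (ae_of_all _ fun _ => sq_nonneg _)
          ((integrable_finsetSum _ fun i _ => (hV i).const_mul _).const_mul _)
          (ae_of_all _ hcauchy)
    _ = (∑ i ∈ I, b i) * ∑ i ∈ I, b i * ∫ ω, V i ω ^ 2 ∂μ := by
        rw [integral_const_mul, integral_finsetSum _ fun i _ => (hV i).const_mul _]
        simp_rw [integral_const_mul]
    _ ≤ (∑ i ∈ I, b i) * ∑ i ∈ I, b i * K :=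
        mul_le_mul_of_nonneg_left (Finset.sum_le_sum fun i hi =>
          mul_le_mul_of_nonneg_left (hK i) (hb i hi)) (Finset.sum_nonneg hb)
    _ = (∑ i ∈ I, b i) ^ 2 * K := by
        rw [← Finset.sum_mul]
        ring

theorem sum_one_div_abs_sub_sq_le (N s : ℕ) :
    ∑ t ∈ Finset.Icc 1 N, 1 / (|(t : ℝ) - s| + 1) ^ 2 ≤ 4 := by
  have side : ∀ (S : Finset ℕ) (f : ℕ → ℕ), Set.InjOn f S → (∀ t ∈ S, |(t : ℝ) - s| = f t) →
      ∑ t ∈ S, 1 / (|(t : ℝ) - s| + 1) ^ 2 ≤ 2 := fun S f hinj hf => by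
    obtain ⟨n, hn⟩ := (S.image f).exists_nat_subset_range
    rw [Finset.sum_congr rfl fun t ht => by rw [hf t ht],
      ← Finset.sum_image (f := fun h : ℕ => 1 / ((h : ℝ) + 1) ^ 2) hinj]
    exact (Finset.sum_le_sum_of_subset_of_nonneg hn fun _ _ _ => by positivity).trans
      (sum_one_div_sq_le_two n)
  have hpast := side {t ∈ Finset.Icc 1 N | t ≤ s} (fun t => s - t)
    (fun a ha b hb (hab : s - a = s - b) => by
      simp only [Finset.coe_filter, Set.mem_ofPred_eq] at ha hb
      omega)
    fun t ht => by
      have hts := (Finset.mem_filter.1 ht).2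
      rw [Nat.cast_sub hts, abs_sub_comm, abs_of_nonneg (sub_nonneg.2 (by exact_mod_cast hts))]
  have hfuture := side {t ∈ Finset.Icc 1 N | ¬ t ≤ s} (fun t => t - s)
    (fun a ha b hb (hab : a - s = b - s) => by
      simp only [Finset.coe_filter, Set.mem_ofPred_eq] at ha hb
      omega)
    fun t ht => by
      have hst := (not_le.1 (Finset.mem_filter.1 ht).2).le
      rw [Nat.cast_sub hst, abs_of_nonneg (sub_nonneg.2 (by exact_mod_cast hst))]
  rw [← Finset.sum_filter_add_sum_filter_not _ fun t => t ≤ s]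
  linarith

theorem variance_sum_mul_le_of_abs_covariance_le [IsFiniteMeasure μ] {X : ℕ → Ω → ℝ}
    (hX : ∀ t, MemLp (X t) 2 μ) {κ : ℝ} (hκ : 0 ≤ κ)
    (hcov : ∀ s t, |cov[X s, X t; μ]| ≤ κ * (1 / (|(t : ℝ) - s| + 1) ^ 2))
    {x : ℕ → ℝ} {B : ℝ} (hx : ∀ t, |x t| ≤ B) (N : ℕ) :
    Var[fun ω => ∑ t ∈ Finset.Icc 1 N, x t * X t ω; μ] ≤ 4 * B ^ 2 * κ * N := by
  have hB : 0 ≤ B := (abs_nonneg _).trans (hx 0)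
  have hterm : ∀ s t, cov[fun ω => x s * X s ω, fun ω => x t * X t ω; μ]
      ≤ B * B * κ * (1 / (|(t : ℝ) - s| + 1) ^ 2) := fun s t => by
    rw [covariance_const_mul_left, covariance_const_mul_right, ← mul_assoc, mul_assoc (B * B)]
    refine (le_abs_self _).trans ?_
    rw [abs_mul, abs_mul]
    exact mul_le_mul (mul_le_mul (hx s) (hx t) (abs_nonneg _) hB) (hcov s t) (abs_nonneg _)
      (mul_nonneg hB hB)
  rw [variance_fun_sum' fun t _ => (hX t).const_mul (x t)]
  calc _ ≤ ∑ s ∈ Finset.Icc 1 N, ∑ t ∈ Finset.Icc 1 N,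
          B * B * κ * (1 / (|(t : ℝ) - s| + 1) ^ 2) :=
        Finset.sum_le_sum fun s _ => Finset.sum_le_sum fun t _ => hterm s t
    _ ≤ ∑ _s ∈ Finset.Icc 1 N, B * B * κ * 4 :=
        Finset.sum_le_sum fun s _ => by
          rw [← Finset.mul_sum]
          exact mul_le_mul_of_nonneg_left (sum_one_div_abs_sub_sq_le N s) (by positivity)
    _ = 4 * B ^ 2 * κ * N := by
        rw [Finset.sum_const, Nat.card_Icc, nsmul_eq_mul, Nat.add_sub_cancel]
        ring

theorem ae_summable_and_integrable_tsum {f : ℕ → Ω → ℝ} (hf_nonneg : ∀ n ω, 0 ≤ f n ω)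
    (hf : ∀ n, Integrable (f n) μ) (hsum : Summable fun n => ∫ ω, f n ω ∂μ) :
    (∀ᵐ ω ∂μ, Summable fun n => f n ω) ∧ Integrable (fun ω => ∑' n, f n ω) μ := by
  have hmeas : ∀ n, AEMeasurable (fun ω => ENNReal.ofReal (f n ω)) μ := fun n =>
    (hf n).aemeasurable.ennreal_ofReal
  have hfinite : ∫⁻ ω, ∑' n, ENNReal.ofReal (f n ω) ∂μ ≠ ∞ := by
    rw [lintegral_tsum hmeas]
    simp_rw [← ofReal_integral_eq_lintegral_ofReal (hf _) (ae_of_all μ (hf_nonneg _))]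
    exact hsum.tsum_ofReal_ne_top
  constructor
  · filter_upwards [ae_lt_top' (AEMeasurable.tsum hmeas) hfinite] with ω hω
    simpa only [ENNReal.toReal_ofReal (hf_nonneg _ ω)] using ENNReal.summable_toReal hω.ne
  · refine (integrable_toReal_of_lintegral_ne_top (AEMeasurable.tsum hmeas) hfinite).congr
      (ae_of_all _ fun ω => ?_)
    simp only [ENNReal.tsum_toReal_eq fun _ => ENNReal.ofReal_ne_top,
      ENNReal.toReal_ofReal (hf_nonneg _ ω)]

theorem variance_sub_le_of_variance_le [IsFiniteMeasure μ] {X X' : Ω → ℝ} (hX : MemLp X 2 μ)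
    (hX' : MemLp X' 2 μ) {r : ℝ} (h : Var[X; μ] ≤ r ^ 2) (h' : Var[X'; μ] ≤ r ^ 2) :
    Var[X - X'; μ] ≤ (2 * r) ^ 2 := by
  have hparallelogram : Var[X - X'; μ] + Var[X + X'; μ] = 2 * Var[X; μ] + 2 * Var[X'; μ] := by
    rw [variance_sub hX hX', variance_add hX hX']
    ring
  nlinarith [variance_nonneg (X + X') μ]

theorem covariance_sub_sub_eq_zero [IsFiniteMeasure μ] {X X' Z Z' : Ω → ℝ} (hX : MemLp X 2 μ)
    (hX' : MemLp X' 2 μ) (hZ : MemLp Z 2 μ) (hZ' : MemLp Z' 2 μ) (hXZ : IndepFun X Z μ)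
    (hXZ' : IndepFun X Z' μ) (hX'Z : IndepFun X' Z μ) (hX'Z' : IndepFun X' Z' μ) :
    cov[X - X', Z - Z'; μ] = 0 := by
  rw [covariance_sub_left hX hX' (hZ.sub hZ'), covariance_sub_right hX hZ hZ',
    covariance_sub_right hX' hZ hZ', hXZ.covariance_eq_zero hX hZ, hXZ'.covariance_eq_zero hX hZ',
    hX'Z.covariance_eq_zero hX' hZ, hX'Z'.covariance_eq_zero hX' hZ']
  simp

/-- The random variable `X` minus its expectation. -/
noncomputable def centred (μ : Measure Ω) (X : Ω → ℝ) (ω : Ω) : ℝ := X ω - ∫ ω', X ω' ∂μ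

theorem integral_centred [IsProbabilityMeasure μ] {X : Ω → ℝ} (hX : Integrable X μ) :
    ∫ ω, centred μ X ω ∂μ = 0 := by
  simp [centred, integral_sub hX (integrable_const _)]

theorem centred_truncApprox_zero [IsProbabilityMeasure μ] {E : Type*} [NormedAddCommGroup E]
    (G : ℤ → (ℤ → E) → ℝ) (Y : ℤ → Ω → E) (t : ℤ) (ω : Ω) :
    centred μ (truncApprox G Y 0 t) ω = 0 := by
  simp [centred, truncApprox, truncEval, truncPast]

theorem lintegral_sum_mul_centred_sub_sq {X X' : ℕ → Ω → ℝ} [IsFiniteMeasure μ]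
    (hX : ∀ t, MemLp (X t) 2 μ) (hX' : ∀ t, MemLp (X' t) 2 μ) (x : ℕ → ℝ) (N : ℕ) :
    ∫⁻ ω, ‖∑ t ∈ Finset.Icc 1 N, x t * (centred μ (X t) ω - centred μ (X' t) ω)‖ₑ ^ 2 ∂μ
      = ENNReal.ofReal (Var[fun ω => ∑ t ∈ Finset.Icc 1 N, x t * (X t ω - X' t ω); μ]) := by
  have hint : ∀ t, Integrable (fun ω => x t * (X t ω - X' t ω)) μ := fun t =>
    (((hX t).integrable one_le_two).sub ((hX' t).integrable one_le_two)).const_mul _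
  have hmem : MemLp (fun ω => ∑ t ∈ Finset.Icc 1 N, x t * (X t ω - X' t ω)) 2 μ :=
    memLp_finsetSum _ fun t _ => ((hX t).sub (hX' t)).const_mul (x t)
  rw [ofReal_variance hmem, evariance, integral_finsetSum _ fun t _ => hint t]
  simp_rw [integral_const_mul, integral_sub ((hX _).integrable one_le_two)
    ((hX' _).integrable one_le_two), ← Finset.sum_sub_distrib, ← mul_sub, centred, sub_sub_sub_comm]

end Moments

section CausalProcess

variable {Ω : Type*} {mΩ : MeasurableSpace Ω} {μ : Measure Ω} {E : Type*} [NormedAddCommGroup E]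
  [MeasurableSpace E]

/-- A sequence `Y` of independent random vectors with uniformly bounded fourth moments, together
with functionals `G` of its past, whose values form the process under study. The normalization
`1 ≤ K` lets the same constant bound the second moments. -/
structure IsCausalProcess (μ : Measure Ω) (G : ℤ → (ℤ → E) → ℝ) (Y : ℤ → Ω → E) (c K : ℝ) :
    Prop where
  lipschitz : IsCausalLipschitz c G
  measurable : ∀ τ, Measurable (Y τ)
  indep : iIndepFun Y μ
  integrable_norm_pow : ∀ τ, Integrable (fun ω => ‖Y τ ω‖ ^ 4) μ
  integral_norm_pow_le : ∀ τ, ∫ ω, ‖Y τ ω‖ ^ 4 ∂μ ≤ K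
  one_le : 1 ≤ K

namespace IsCausalProcess

variable {G : ℤ → (ℤ → E) → ℝ} {Y : ℤ → Ω → E} {c K : ℝ}

theorem timeField_le (hP : IsCausalProcess μ G Y c K) (I : Set ℤ) : timeField Y I ≤ mΩ :=
  iSup₂_le fun τ _ => (hP.measurable τ).comap_le

theorem indep_timeField (hP : IsCausalProcess μ G Y c K) {I J : Set ℤ} (hIJ : Disjoint I J) :
    Indep (timeField Y I) (timeField Y J) μ :=
  indep_iSup_of_disjoint (fun τ => (hP.measurable τ).comap_le) hP.indep hIJ

theorem scale_nonneg (hP : IsCausalProcess μ G Y c K) : 0 ≤ c * √K :=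
  mul_nonneg hP.lipschitz.nonneg (Real.sqrt_nonneg K)

section Moments

variable [OpensMeasurableSpace E] [IsProbabilityMeasure μ]

theorem integrable_norm_sq (hP : IsCausalProcess μ G Y c K) (τ : ℤ) :
    Integrable (fun ω => ‖Y τ ω‖ ^ 2) μ := by
  refine ((integrable_const 1).add (hP.integrable_norm_pow τ)).mono'
    ((hP.measurable τ).norm.pow_const 2).aestronglyMeasurable (ae_of_all _ fun ω => ?_)
  rw [Real.norm_eq_abs, abs_of_nonneg (sq_nonneg _), Pi.add_apply]
  nlinarith [sq_nonneg (‖Y τ ω‖ ^ 2 - 1)]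

theorem integral_norm_sq_le (hP : IsCausalProcess μ G Y c K) (τ : ℤ) :
    ∫ ω, ‖Y τ ω‖ ^ 2 ∂μ ≤ K := by
  have hyoung : ∫ ω, 2 * ‖Y τ ω‖ ^ 2 ∂μ ≤ ∫ ω, (1 + ‖Y τ ω‖ ^ 4) ∂μ :=
    integral_mono ((hP.integrable_norm_sq τ).const_mul 2)
      ((integrable_const 1).add (hP.integrable_norm_pow τ)) fun ω => by
        nlinarith [sq_nonneg (‖Y τ ω‖ ^ 2 - 1)]
  rw [integral_const_mul, integral_add (integrable_const 1) (hP.integrable_norm_pow τ)] at hyoung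
  simp only [integral_const, probReal_univ, one_smul] at hyoung
  linarith [hP.integral_norm_pow_le τ, hP.one_le]

theorem ae_hasSummablePast_and_integrable (hP : IsCausalProcess μ G Y c K) (t : ℤ) :
    (∀ᵐ ω ∂μ, HasSummablePast t fun τ => Y τ ω) ∧
      Integrable (fun ω => ∑' h : ℕ, lagWeight h * ‖Y (t - h) ω‖) μ := by
  have hint : ∀ τ, Integrable (fun ω => ‖Y τ ω‖) μ := fun τ =>
    ((integrable_const 1).add (hP.integrable_norm_sq τ)).mono'
      (hP.measurable τ).norm.aestronglyMeasurable (ae_of_all _ fun ω => by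
        rw [norm_norm, Pi.add_apply]
        nlinarith [sq_nonneg (‖Y τ ω‖ - 1)])
  have hle : ∀ τ, ∫ ω, ‖Y τ ω‖ ∂μ ≤ 1 + K := fun τ =>
    calc ∫ ω, ‖Y τ ω‖ ∂μ ≤ ∫ ω, (1 + ‖Y τ ω‖ ^ 2) ∂μ :=
          integral_mono (hint τ) ((integrable_const 1).add (hP.integrable_norm_sq τ)) fun ω => by
            nlinarith [sq_nonneg (‖Y τ ω‖ - 1)]
      _ = 1 + ∫ ω, ‖Y τ ω‖ ^ 2 ∂μ := by
          simp [integral_add (integrable_const 1) (hP.integrable_norm_sq τ)]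
      _ ≤ 1 + K := add_le_add_right (hP.integral_norm_sq_le τ) 1
  refine ae_summable_and_integrable_tsum
    (fun h ω => mul_nonneg (lagWeight_nonneg h) (norm_nonneg _))
    (fun h => (hint _).const_mul _) ?_
  simp_rw [integral_const_mul]
  exact (summable_lagWeight.mul_right (1 + K)).of_nonneg_of_le
    (fun h => mul_nonneg (lagWeight_nonneg h) (integral_nonneg fun _ => norm_nonneg _))
    fun h => mul_le_mul_of_nonneg_left (hle _) (lagWeight_nonneg h)

theorem integral_truncEval_sub_sq_le (hP : IsCausalProcess μ G Y c K) {k l : ℕ} {r s t : ℤ}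
    (hrs : r ≤ s) (hst : s ≤ t) {δ : ℝ} (hδ : 0 ≤ δ)
    (hclip : ∀ v : E, ‖clip (l + 1) v - clip (k + 1) v‖ ≤ δ * ‖v‖ ^ 2) :
    ∫ ω, (truncEval G Y l r t ω - truncEval G Y k s t ω) ^ 2 ∂μ
      ≤ (c * (2 * δ + 2 / (((t - s).toNat : ℝ) + 1) ^ 2)) ^ 2 * K := by
  have hlag : ∀ h < (t - r).toNat, ∀ ω,
      ‖truncPast l r t (fun τ => Y τ ω) (t - h) - truncPast k s t (fun τ => Y τ ω) (t - h)‖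
        ≤ (if h < (t - s).toNat then δ else 1)
          * (if h < (t - s).toNat then ‖Y (t - h) ω‖ ^ 2 else ‖Y (t - h) ω‖) := fun h hh ω => by
    split_ifs with hs
    · rw [truncPast_of_mem l ⟨by omega, by omega⟩, truncPast_of_mem k ⟨by omega, by omega⟩]
      exact hclip _
    · rw [truncPast_of_le k (show t - (h : ℤ) ≤ s by omega), sub_zero, one_mul]
      exact norm_truncPast_le_norm l r t (fun τ => Y τ ω) _
  have habs : ∀ ω, |truncEval G Y l r t ω - truncEval G Y k s t ω|
      ≤ ∑ h ∈ Finset.range (t - r).toNat, c * (lagWeight h * (if h < (t - s).toNat then δ else 1))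
        * (if h < (t - s).toNat then ‖Y (t - h) ω‖ ^ 2 else ‖Y (t - h) ω‖) := fun ω => by
    simp_rw [mul_assoc]
    refine hP.lipschitz.abs_sub_le_sum (hasSummablePast_truncPast l r t _)
      (hasSummablePast_truncPast k s t _) (fun h hh => ?_) fun h hh => hlag h hh ω
    rw [truncPast_of_le l (by omega), truncPast_of_le k (by omega)]
  have hbound := integral_sq_le_of_abs_le_sum (μ := μ) (K := K) (fun h _ => mul_nonneg
      hP.lipschitz.nonneg (mul_nonneg (lagWeight_nonneg h) (by split_ifs <;> positivity)))
    (fun h => by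
      split_ifs
      · simpa only [← pow_mul] using hP.integrable_norm_pow _
      · exact hP.integrable_norm_sq _)
    (fun h => by
      split_ifs
      · simpa only [← pow_mul] using hP.integral_norm_pow_le _
      · exact hP.integral_norm_sq_le _) habs
  rw [← Finset.mul_sum] at hbound
  refine hbound.trans (mul_le_mul_of_nonneg_right ?_ (zero_le_one.trans hP.one_le))
  have hsum_nonneg := Finset.sum_nonneg fun (h : ℕ) (_ : h ∈ Finset.range (t - r).toNat) =>
    mul_nonneg (lagWeight_nonneg h)
      (show 0 ≤ if h < (t - s).toNat then δ else 1 by split_ifs <;> positivity)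
  have := hP.lipschitz.nonneg
  gcongr
  exact sum_lagWeight_mul_ite_le _ _ hδ

theorem ae_tendsto_truncApprox (hP : IsCausalProcess μ G Y c K) (t : ℤ) :
    ∀ᵐ ω ∂μ, Tendsto (fun k => truncApprox G Y k t ω) atTop (𝓝 (G t fun τ => Y τ ω)) := by
  filter_upwards [(hP.ae_hasSummablePast_and_integrable t).1] with ω hω
  refine tendsto_iff_dist_tendsto_zero.2 (squeeze_zero (fun _ => dist_nonneg)
    (fun k => hP.lipschitz.abs_sub_le t _ _ (hasSummablePast_truncPast k _ t _) hω) ?_)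
  rw [← mul_zero c, ← tsum_zero (β := ℕ)]
  refine (tendsto_tsum_of_dominated_convergence hω (fun h => ?_)
    (.of_forall fun k h => ?_)).const_mul c
  · have h := ((tendsto_truncPast t (fun τ => Y τ ω) (τ := t - h) (by omega)).sub_const
      (Y (t - h) ω)).norm.const_mul (lagWeight h)
    simpa using h
  · rw [Real.norm_eq_abs, abs_of_nonneg (mul_nonneg (lagWeight_nonneg h) (norm_nonneg _))]
    exact mul_le_mul_of_nonneg_left (norm_truncPast_sub_self_le k _ t _ _) (lagWeight_nonneg h)

end Moments

section BorelSpace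

variable [BorelSpace E] [SecondCountableTopology E]

theorem measurable_truncEval (hP : IsCausalProcess μ G Y c K) (k : ℕ) (s t : ℤ) :
    Measurable (truncEval G Y k s t) :=
  (hP.lipschitz.measurable_truncEval Y k s t).mono (hP.timeField_le _) le_rfl

theorem indepFun_truncEval (hP : IsCausalProcess μ G Y c K) (k l : ℕ) {r s r' t : ℤ}
    (h : s ≤ r') : IndepFun (truncEval G Y k r s) (truncEval G Y l r' t) μ :=
  indep_of_indep_of_le_left (indep_of_indep_of_le_right
    (hP.indep_timeField (Set.Ioc_disjoint_Ioc_of_le h))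
    (hP.lipschitz.measurable_truncEval Y l r' t).comap_le)
    (hP.lipschitz.measurable_truncEval Y k r s).comap_le

theorem kDependent_truncApprox (hP : IsCausalProcess μ G Y c K) (k : ℕ) :
    KDependent μ k fun t : ℕ => centred μ (truncApprox G Y k t) := fun A B hAB => by
  have hmeas : ∀ A : Finset ℕ, Measurable[timeField Y (⋃ a ∈ A, Set.Ioc ((a : ℤ) - k) a)]
      (fun ω (a : A) => centred μ (truncApprox G Y k (a : ℕ)) ω) := fun A =>
    (@measurable_pi_iff _ _ _ (timeField Y _) _ _).2 fun a =>
      ((hP.lipschitz.measurable_truncEval Y k _ _).mono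
        (biSup_mono fun τ hτ => Set.mem_biUnion a.2 hτ) le_rfl).sub_const _
  have hdisj : Disjoint (⋃ a ∈ A, Set.Ioc ((a : ℤ) - k) a) (⋃ b ∈ B, Set.Ioc ((b : ℤ) - k) b) := by
    simp only [Set.disjoint_iUnion_left, Set.disjoint_iUnion_right]
    intro b hb a ha
    have hfar := hAB a ha b hb
    rw [Set.Ioc_disjoint_Ioc]
    simp only [Near] at hfar
    omega
  exact indep_of_indep_of_le_left (indep_of_indep_of_le_right (hP.indep_timeField hdisj)
    (hmeas B).comap_le) (hmeas A).comap_le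

variable [IsProbabilityMeasure μ]

theorem memLp_truncEval (hP : IsCausalProcess μ G Y c K) (k : ℕ) (s t : ℤ) (p : ℝ≥0∞) :
    MemLp (truncEval G Y k s t) p μ :=
  MemLp.of_bound (hP.measurable_truncEval k s t).aestronglyMeasurable
    (2 * c * (k + 1) + |G t 0|) (ae_of_all _ fun ω => by
      rw [Real.norm_eq_abs]
      linarith [hP.lipschitz.abs_truncEval_sub_le Y k s t ω,
        abs_sub_abs_le_abs_sub (truncEval G Y k s t ω) (G t 0)])

theorem variance_truncEval_sub_le (hP : IsCausalProcess μ G Y c K) {k l : ℕ} {r s t : ℤ}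
    (hrs : r ≤ s) (hst : s ≤ t) {δ b : ℝ} (hδ : 0 ≤ δ)
    (hclip : ∀ v : E, ‖clip (l + 1) v - clip (k + 1) v‖ ≤ δ * ‖v‖ ^ 2)
    (hb : 2 * δ + 2 / (((t - s).toNat : ℝ) + 1) ^ 2 ≤ b) :
    Var[truncEval G Y l r t - truncEval G Y k s t; μ] ≤ (b * (c * √K)) ^ 2 := by
  have hK := zero_le_one.trans hP.one_le
  have hc := hP.lipschitz.nonneg
  calc Var[truncEval G Y l r t - truncEval G Y k s t; μ]
      ≤ ∫ ω, (truncEval G Y l r t ω - truncEval G Y k s t ω) ^ 2 ∂μ :=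
        variance_le_expectation_sq
          ((hP.measurable_truncEval l r t).sub (hP.measurable_truncEval k s t)).aestronglyMeasurable
    _ ≤ (c * (2 * δ + 2 / (((t - s).toNat : ℝ) + 1) ^ 2)) ^ 2 * K :=
        hP.integral_truncEval_sub_sq_le hrs hst hδ hclip
    _ ≤ (c * b) ^ 2 * K := by gcongr
    _ = (b * (c * √K)) ^ 2 := by
        rw [← mul_assoc, mul_pow _ √K, Real.sq_sqrt hK, mul_comm b]

theorem variance_truncEval_sub_max_le (hP : IsCausalProcess μ G Y c K) (k : ℕ) (r : ℤ) {s t : ℤ}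
    (hst : s ≤ t) : Var[truncEval G Y k r t - truncEval G Y k (max s r) t; μ]
      ≤ (2 / (((t - s).toNat : ℝ) + 1) ^ 2 * (c * √K)) ^ 2 := by
  rcases le_total s r with hsr | hrs
  · rw [max_eq_right hsr, sub_self, variance_zero]
    positivity
  · rw [max_eq_left hrs]
    exact hP.variance_truncEval_sub_le hrs hst le_rfl (by simp) (by simp)

theorem variance_truncApprox_sub_le (hP : IsCausalProcess μ G Y c K) {k l : ℕ} (hkl : k ≤ l)
    (t : ℤ) : Var[truncApprox G Y l t - truncApprox G Y k t; μ]
      ≤ (4 / ((k : ℝ) + 1) * (c * √K)) ^ 2 := by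
  refine hP.variance_truncEval_sub_le (δ := 1 / ((k : ℝ) + 1)) (by omega) (by omega)
    (by positivity) (fun v => norm_clip_sub_clip_le (by positivity) (by gcongr) v) ?_
  have hsq : ((k : ℝ) + 1) ≤ (k + 1) ^ 2 := by nlinarith [(Nat.cast_nonneg k : (0 : ℝ) ≤ k)]
  have hinv : 2 / ((k : ℝ) + 1) ^ 2 ≤ 2 / ((k : ℝ) + 1) := by gcongr
  rw [sub_sub_cancel, Int.toNat_natCast]
  linarith [show (4 : ℝ) / (k + 1) = 2 * (1 / (k + 1)) + 2 / (k + 1) by ring]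

theorem memLp_truncApprox (hP : IsCausalProcess μ G Y c K) (k : ℕ) (t : ℤ) (p : ℝ≥0∞) :
    MemLp (truncApprox G Y k t) p μ :=
  hP.memLp_truncEval k (t - k) t p

theorem abs_covariance_truncApprox_sub_le (hP : IsCausalProcess μ G Y c K) {k l : ℕ}
    (hkl : k ≤ l) {s t : ℤ} (hst : s ≤ t) :
    |cov[truncApprox G Y l s - truncApprox G Y k s, truncApprox G Y l t - truncApprox G Y k t; μ]|
      ≤ 16 * (c * √K) ^ 2 / (k + 1) * (1 / (((t - s).toNat : ℝ) + 1) ^ 2) := by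
  have hmem := fun j r => hP.memLp_truncApprox j r 2
  have hmem' := fun j => hP.memLp_truncEval j (max s (t - j)) t 2
  have hindep : ∀ i j : ℕ,
      IndepFun (truncApprox G Y i s) (truncEval G Y j (max s (t - j)) t) μ := fun i j =>
    hP.indepFun_truncEval i j (le_max_left s _)
  set past := truncApprox G Y l s - truncApprox G Y k s
  set present := truncApprox G Y l t - truncApprox G Y k t with hpresent
  set recent := truncEval G Y l (max s (t - l)) t - truncEval G Y k (max s (t - k)) t with hrecent
  have hpast_memLp : MemLp past 2 μ := (hmem l s).sub (hmem k s)
  have hrecent_memLp : MemLp recent 2 μ := (hmem' l).sub (hmem' k)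
  have hpresent_memLp : MemLp present 2 μ := (hmem l t).sub (hmem k t)
  have hforgotten : Var[present - recent; μ]
      ≤ (2 * (2 / (((t - s).toNat : ℝ) + 1) ^ 2 * (c * √K))) ^ 2 := by
    rw [hpresent, hrecent, sub_sub_sub_comm]
    exact variance_sub_le_of_variance_le ((hmem l t).sub (hmem' l)) ((hmem k t).sub (hmem' k))
      (hP.variance_truncEval_sub_max_le l (t - l) hst)
      (hP.variance_truncEval_sub_max_le k (t - k) hst)
  have huncorrelated : cov[past, recent; μ] = 0 :=
    covariance_sub_sub_eq_zero (hmem l s) (hmem k s) (hmem' l) (hmem' k) (hindep l l) (hindep l k)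
      (hindep k l) (hindep k k)
  have hcov : cov[past, present; μ] = cov[past, present - recent; μ] := by
    rw [covariance_sub_right hpast_memLp hpresent_memLp hrecent_memLp, huncorrelated, sub_zero]
  have hscale := hP.scale_nonneg
  rw [hcov]
  refine (abs_covariance_le_of_variance_le hpast_memLp (hpresent_memLp.sub hrecent_memLp)
    (by positivity) (by positivity) (hP.variance_truncApprox_sub_le hkl s) hforgotten).trans_eq ?_
  ring

theorem variance_sum_mul_truncApprox_sub_le (hP : IsCausalProcess μ G Y c K) {k l : ℕ}
    (hkl : k ≤ l) {x : ℕ → ℝ} {B : ℝ} (hx : ∀ t, |x t| ≤ B) (N : ℕ) :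
    Var[fun ω => ∑ t ∈ Finset.Icc 1 N, x t * (truncApprox G Y l t ω - truncApprox G Y k t ω); μ]
      ≤ 64 * B ^ 2 * (c * √K) ^ 2 / (k + 1) * N := by
  have hcov_of_le : ∀ s t : ℕ, s ≤ t → |cov[truncApprox G Y l s - truncApprox G Y k s,
        truncApprox G Y l t - truncApprox G Y k t; μ]|
      ≤ 16 * (c * √K) ^ 2 / (k + 1) * (1 / (|(t : ℝ) - s| + 1) ^ 2) := fun s t hst => by
    have h := hP.abs_covariance_truncApprox_sub_le hkl (Int.ofNat_le.2 hst)
    rwa [show ((t : ℤ) - s).toNat = t - s by omega, Nat.cast_sub hst,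
      ← abs_of_nonneg (sub_nonneg.2 (Nat.cast_le (α := ℝ) |>.2 hst))] at h
  refine (variance_sum_mul_le_of_abs_covariance_le
    (X := fun t : ℕ => truncApprox G Y l t - truncApprox G Y k t)
    (κ := 16 * (c * √K) ^ 2 / (k + 1))
    (fun t => (hP.memLp_truncApprox l t 2).sub (hP.memLp_truncApprox k t 2)) (by positivity)
    (fun s t => ?_) hx N).trans_eq (by ring)
  rcases le_total s t with hst | hts
  · exact hcov_of_le s t hst
  · rw [covariance_comm, abs_sub_comm]
    exact hcov_of_le t s hts

theorem tendsto_integral_truncApprox (hP : IsCausalProcess μ G Y c K) (t : ℤ) :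
    Tendsto (fun k => ∫ ω, truncApprox G Y k t ω ∂μ) atTop (𝓝 (∫ ω, G t (fun τ => Y τ ω) ∂μ)) := by
  obtain ⟨hsummable, hintegrable⟩ := hP.ae_hasSummablePast_and_integrable t
  refine tendsto_integral_of_dominated_convergence
    (fun ω => |G t 0| + c * ∑' h : ℕ, lagWeight h * ‖Y (t - h) ω‖)
    (fun k => (hP.measurable_truncEval k _ t).aestronglyMeasurable)
    ((integrable_const _).add (hintegrable.const_mul c)) (fun k => ?_) (hP.ae_tendsto_truncApprox t)
  filter_upwards [hsummable] with ω hω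
  have hdist : |truncApprox G Y k t ω - G t 0| ≤ c * ∑' h : ℕ, lagWeight h * ‖Y (t - h) ω‖ :=
    hP.lipschitz.abs_sub_le_tsum (hasSummablePast_truncPast k (t - k) t fun τ => Y τ ω)
      (hasSummablePast_of_eq_zero (s := t) fun _ _ => rfl) hω fun h => by
        rw [sub_zero]
        exact norm_truncPast_le_norm k _ t (fun τ => Y τ ω) _
  rw [Real.norm_eq_abs]
  linarith [abs_sub_abs_le_abs_sub (truncApprox G Y k t ω) (G t 0)]

theorem ae_tendsto_centred_truncApprox (hP : IsCausalProcess μ G Y c K) (t : ℤ) :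
    ∀ᵐ ω ∂μ, Tendsto (fun k => centred μ (truncApprox G Y k t) ω) atTop
      (𝓝 (centred μ (fun ω => G t fun τ => Y τ ω) ω)) := by
  filter_upwards [hP.ae_tendsto_truncApprox t] with ω hω
  exact hω.sub (hP.tendsto_integral_truncApprox t)

theorem lintegral_sum_mul_centred_sub_truncApprox_le (hP : IsCausalProcess μ G Y c K) (k : ℕ)
    {x : ℕ → ℝ} {B : ℝ} (hx : ∀ t, |x t| ≤ B) (N : ℕ) :
    ∫⁻ ω, ‖∑ t ∈ Finset.Icc 1 N, x t * (centred μ (fun ω => G t fun τ => Y τ ω) ω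
        - centred μ (truncApprox G Y k t) ω)‖ₑ ^ 2 ∂μ
      ≤ ENNReal.ofReal (64 * B ^ 2 * (c * √K) ^ 2 / (k + 1) * N) := by
  let F : ℕ → Ω → ℝ := fun l ω => ∑ t ∈ Finset.Icc 1 N,
    x t * (centred μ (truncApprox G Y l t) ω - centred μ (truncApprox G Y k t) ω)
  have hF : ∀ l, Measurable (F l) := fun l => Finset.measurable_sum _ fun t _ =>
    (((hP.measurable_truncEval l _ t).sub_const _).sub
      ((hP.measurable_truncEval k _ t).sub_const _)).const_mul _
  have hlim : ∀ᵐ ω ∂μ, liminf (fun l => ‖F l ω‖ₑ ^ 2) atTop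
      = ‖∑ t ∈ Finset.Icc 1 N, x t * (centred μ (fun ω => G t fun τ => Y τ ω) ω
        - centred μ (truncApprox G Y k t) ω)‖ₑ ^ 2 := by
    filter_upwards [ae_all_iff.2 fun t : ℕ => hP.ae_tendsto_centred_truncApprox t] with ω hω
    exact (ENNReal.Tendsto.pow (Tendsto.enorm (tendsto_finsetSum _ fun t _ =>
      ((hω t).sub_const _).const_mul _))).liminf_eq
  rw [← lintegral_congr_ae hlim]
  refine (lintegral_liminf_le fun l => (hF l).enorm.pow_const 2).trans
    (liminf_le_of_frequently_le' (Eventually.frequently ?_))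
  filter_upwards [eventually_ge_atTop k] with l hkl
  rw [lintegral_sum_mul_centred_sub_sq (fun t => hP.memLp_truncApprox l t 2)
    fun t => hP.memLp_truncApprox k t 2]
  exact ENNReal.ofReal_le_ofReal (hP.variance_sum_mul_truncApprox_sub_le hkl hx N)

theorem lintegral_sum_mul_centred_le (hP : IsCausalProcess μ G Y c K) {x : ℕ → ℝ} {B : ℝ}
    (hx : ∀ t, |x t| ≤ B) (N : ℕ) :
    ∫⁻ ω, ‖∑ t ∈ Finset.Icc 1 N, x t * centred μ (fun ω => G t fun τ => Y τ ω) ω‖ₑ ^ 2 ∂μ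
      ≤ ENNReal.ofReal (64 * B ^ 2 * (c * √K) ^ 2 * N) := by
  simpa [centred_truncApprox_zero] using hP.lintegral_sum_mul_centred_sub_truncApprox_le 0 hx N

theorem lintegral_sum_mul_centred_truncApprox_le (hP : IsCausalProcess μ G Y c K) (k : ℕ)
    {x : ℕ → ℝ} {B : ℝ} (hx : ∀ t, |x t| ≤ B) (N : ℕ) :
    ∫⁻ ω, ‖∑ t ∈ Finset.Icc 1 N, x t * centred μ (truncApprox G Y k t) ω‖ₑ ^ 2 ∂μ
      ≤ ENNReal.ofReal (64 * B ^ 2 * (c * √K) ^ 2 * N) := by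
  have hsq := lintegral_sum_mul_centred_sub_sq (fun t => hP.memLp_truncApprox k t 2)
    (fun t => hP.memLp_truncApprox 0 t 2) x N
  simp only [centred_truncApprox_zero, sub_zero] at hsq
  rw [hsq]
  exact ENNReal.ofReal_le_ofReal
    (by simpa using hP.variance_sum_mul_truncApprox_sub_le (Nat.zero_le k) hx N)

theorem isBoundedCentred_truncApprox (hP : IsCausalProcess μ G Y c K) (k : ℕ) :
    IsBoundedCentred μ (4 * c * (k + 1)) fun t : ℕ => centred μ (truncApprox G Y k t) where
  measurable t := (hP.measurable_truncEval k _ t).sub_const _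
  integral_eq_zero t := integral_centred ((hP.memLp_truncApprox k t 1).integrable le_rfl)
  abs_le t ω := by
    have hint := (hP.memLp_truncApprox k t 1).integrable le_rfl
    have hdev : ∀ ω, |truncApprox G Y k t ω - G t 0| ≤ 2 * c * (k + 1) :=
      hP.lipschitz.abs_truncEval_sub_le Y k _ t
    have hmean : |∫ ω, truncApprox G Y k t ω ∂μ - G t 0| ≤ 2 * c * (k + 1) := by
      have h := norm_integral_le_of_norm_le_const (μ := μ)
        (f := fun ω => truncApprox G Y k t ω - G t 0) (ae_of_all μ hdev)
      rwa [integral_sub hint (integrable_const _), integral_const, probReal_univ, one_smul,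
        mul_one, Real.norm_eq_abs] at h
    have h := abs_sub_le (truncApprox G Y k t ω) (G t 0) (∫ ω, truncApprox G Y k t ω ∂μ)
    rw [abs_sub_comm (G t 0)] at h
    exact h.trans (by linarith [hdev ω])

end BorelSpace

end IsCausalProcess

end CausalProcess

/-! ### Deviations of the score -/

section Deviation

variable {Ω : Type*} {mΩ : MeasurableSpace Ω} {μ : Measure Ω} {e : ℤ → Ω → ℝ} {x : ℕ → ℕ → ℝ}
  {T p k : ℕ} {B C R b : ℝ}

theorem aemeasurable_score (he : ∀ t : ℕ, AEMeasurable (e t) μ) (x : ℕ → ℕ → ℝ) (T j : ℕ) :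
    AEMeasurable (fun ω => score x T (fun t => e t ω) j) μ :=
  Finset.aemeasurable_fun_sum _ fun t _ => (he t).const_mul _

theorem aemeasurable_scoreSq (he : ∀ t : ℕ, AEMeasurable (e t) μ) (x : ℕ → ℕ → ℝ) (T p : ℕ) :
    AEMeasurable (fun ω => scoreSq x T p fun t => e t ω) μ :=
  Finset.aemeasurable_fun_sum _ fun j _ => (aemeasurable_score he x T j).pow_const 2

theorem lintegral_scoreSq_le (he : ∀ t : ℕ, AEMeasurable (e t) μ)
    (h : ∀ j, ∫⁻ ω, ‖score x T (fun t => e t ω) j‖ₑ ^ 2 ∂μ ≤ ENNReal.ofReal (C * T)) (p : ℕ) :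
    ∫⁻ ω, ENNReal.ofReal (scoreSq x T p fun t => e t ω) ∂μ ≤ ENNReal.ofReal (C * (p * T)) := by
  have hexpand : ∀ ω, ENNReal.ofReal (scoreSq x T p fun t => e t ω)
      = ∑ j ∈ Finset.range p, ‖score x T (fun t => e t ω) j‖ₑ ^ 2 := fun ω => by
    rw [scoreSq, ENNReal.ofReal_sum_of_nonneg fun _ _ => sq_nonneg _]
    refine Finset.sum_congr rfl fun j _ => ?_
    rw [← sq_abs, ENNReal.ofReal_pow (abs_nonneg _), Real.enorm_eq_ofReal_abs]
  simp_rw [hexpand]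
  rw [lintegral_finsetSum' _ fun j _ => (aemeasurable_score he x T j).enorm.pow_const 2]
  refine (Finset.sum_le_sum fun j _ => h j).trans_eq ?_
  rw [Finset.sum_const, Finset.card_range, nsmul_eq_mul, ← ENNReal.ofReal_natCast,
    ← ENNReal.ofReal_mul (by positivity), mul_left_comm]

theorem meas_le_scoreSq_le (he : ∀ t : ℕ, AEMeasurable (e t) μ)
    (h : ∀ j, ∫⁻ ω, ‖score x T (fun t => e t ω) j‖ₑ ^ 2 ∂μ ≤ ENNReal.ofReal (C * T))
    (p : ℕ) {a : ℝ} (ha : 0 < a) :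
    μ {ω | a ≤ scoreSq x T p fun t => e t ω} ≤ ENNReal.ofReal (C * (p * T) / a) := by
  have hmarkov := meas_ge_le_lintegral_div (aemeasurable_scoreSq he x T p).ennreal_ofReal
    (ENNReal.ofReal_pos.2 ha).ne' ENNReal.ofReal_ne_top
  rw [ENNReal.ofReal_div_of_pos ha]
  exact (measure_mono fun ω hω => ENNReal.ofReal_le_ofReal hω).trans
    (hmarkov.trans (ENNReal.div_le_div_right (lintegral_scoreSq_le he h p) _))

theorem scoreSq_le_two_mul_add (x : ℕ → ℕ → ℝ) (T p : ℕ) (e f : ℤ → ℝ) :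
    scoreSq x T p e ≤ 2 * scoreSq x T p f + 2 * scoreSq x T p (fun t => e t - f t) := by
  simp_rw [scoreSq, Finset.mul_sum, ← Finset.sum_add_distrib]
  refine Finset.sum_le_sum fun j _ => ?_
  have hsub : score x T (fun t => e t - f t) j = score x T e j - score x T f j := by
    simp [score, mul_sub]
  rw [hsub]
  nlinarith [sq_nonneg (score x T e j - 2 * score x T f j)]

theorem meas_le_scoreSq_le_add (e f : ℤ → Ω → ℝ) (x : ℕ → ℕ → ℝ) (T p : ℕ) (a : ℝ) :
    μ {ω | 4 * a ≤ scoreSq x T p fun t => e t ω} ≤ μ {ω | a ≤ scoreSq x T p fun t => f t ω}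
      + μ {ω | a ≤ scoreSq x T p fun t => e t ω - f t ω} := by
  refine (measure_mono fun ω (hω : 4 * a ≤ scoreSq x T p fun t => e t ω) => ?_).trans
    (measure_union_le _ _)
  have hsplit := scoreSq_le_two_mul_add x T p (fun t => e t ω) fun t => f t ω
  rcases le_or_gt a (scoreSq x T p fun t => f t ω) with hf | hf
  · exact Or.inl hf
  · exact Or.inr (show a ≤ scoreSq x T p fun t => e t ω - f t ω by linarith)

theorem scoreSq_eq_quadForm (x : ℕ → ℕ → ℝ) (T p : ℕ) (e : ℤ → ℝ) :
    scoreSq x T p e = ∑ P ∈ Finset.Icc 1 T ×ˢ Finset.Icc 1 T,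
      (∑ j ∈ Finset.range p, x P.1 j * x P.2 j) * (e P.1 * e P.2) := by
  simp_rw [scoreSq, score, pow_two, Finset.sum_mul_sum, Finset.sum_product, Finset.sum_mul]
  rw [Finset.sum_comm]
  refine Finset.sum_congr rfl fun s _ => ?_
  rw [Finset.sum_comm]
  exact Finset.sum_congr rfl fun t _ => Finset.sum_congr rfl fun j _ => by ring

variable [IsProbabilityMeasure μ]

theorem memLp_scoreSq (he : IsBoundedCentred μ R fun t : ℕ => e t) (x : ℕ → ℕ → ℝ) (T p : ℕ) :
    MemLp (fun ω => scoreSq x T p fun t => e t ω) 2 μ := by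
  simp_rw [scoreSq_eq_quadForm]
  exact memLp_finsetSum _ fun P _ => (he.memLp_mul P.1 P.2).const_mul _

theorem variance_scoreSq_le (he : IsBoundedCentred μ R fun t : ℕ => e t)
    (hk : KDependent μ k fun t : ℕ => e t) (hx : ∀ t j, |x t j| ≤ B) (hT : 1 ≤ T)
    (hspec : ∀ κ ∈ spectrum ℝ (gramMatrix x T p), |κ| ≤ b) :
    Var[fun ω => scoreSq x T p fun t => e t ω; μ]
      ≤ R ^ 4 * (2 * (2 * k + 1) ^ 2 * (T ^ 2 * (p * b ^ 2))
        + (6 * k + 1) ^ 2 * (T * ((6 * k + 1) * (p * B ^ 2) ^ 2))) := by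
  have hB : 0 ≤ B := (abs_nonneg _).trans (hx 0 0)
  have houter : ∀ s t, |∑ j ∈ Finset.range p, x s j * x t j| ≤ p * B ^ 2 := fun s t =>
    calc _ ≤ ∑ j ∈ Finset.range p, |x s j * x t j| := Finset.abs_sum_le_sum_abs _ _
      _ ≤ ∑ _j ∈ Finset.range p, B ^ 2 := Finset.sum_le_sum fun j _ => by
          rw [abs_mul, pow_two]
          exact mul_le_mul (hx s j) (hx t j) (abs_nonneg _) hB
      _ = p * B ^ 2 := by simp
  have hvar := he.variance_quadForm_le hk (Finset.Icc 1 T) houter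
  rw [Nat.card_Icc, Nat.add_sub_cancel] at hvar
  simp_rw [scoreSq_eq_quadForm]
  refine hvar.trans ?_
  gcongr
  exact sum_sq_outerGram_le hT hspec

theorem integral_scoreSq_le (he : IsBoundedCentred μ R fun t : ℕ => e t) (hC : 0 ≤ C)
    (h : ∀ j, ∫⁻ ω, ‖score x T (fun t => e t ω) j‖ₑ ^ 2 ∂μ ≤ ENNReal.ofReal (C * T)) :
    ∫ ω, scoreSq x T p (fun t => e t ω) ∂μ ≤ C * (p * T) := by
  rw [integral_eq_lintegral_of_nonneg_ae (ae_of_all _ fun _ => scoreSq_nonneg _ _ _ _)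
    (memLp_scoreSq he x T p).aestronglyMeasurable]
  exact ENNReal.toReal_le_of_le_ofReal (by positivity)
    (lintegral_scoreSq_le (fun t => (he.measurable t).aemeasurable) h p)

theorem meas_le_scoreSq_le_of_kDependent (he : IsBoundedCentred μ R fun t : ℕ => e t)
    (hk : KDependent μ k fun t : ℕ => e t) (hC : 0 < C)
    (h : ∀ j, ∫⁻ ω, ‖score x T (fun t => e t ω) j‖ₑ ^ 2 ∂μ ≤ ENNReal.ofReal (C * T))
    (hx : ∀ t j, |x t j| ≤ B) (hT : 1 ≤ T) (hp : 1 ≤ p)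
    (hspec : ∀ κ ∈ spectrum ℝ (gramMatrix x T p), |κ| ≤ b) :
    μ {ω | 2 * C * (p * T) ≤ scoreSq x T p fun t => e t ω}
      ≤ ENNReal.ofReal (R ^ 4 / C ^ 2 * (2 * (2 * k + 1) ^ 2 * b ^ 2 * (1 / p)
        + (6 * k + 1) ^ 2 * (6 * k + 1) * B ^ 4 * (1 / T))) := by
  have hT' : (0 : ℝ) < T := by exact_mod_cast hT
  have hp' : (0 : ℝ) < p := by exact_mod_cast hp
  have hmean := integral_scoreSq_le (p := p) he hC.le h
  have hchebyshev := meas_ge_le_variance_div_sq (memLp_scoreSq he x T p)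
    (show 0 < C * (p * T) by positivity)
  refine (measure_mono fun ω (hω : 2 * C * (p * T) ≤ scoreSq x T p fun t => e t ω) => ?_).trans
    (hchebyshev.trans (ENNReal.ofReal_le_ofReal ?_))
  · have hdev : C * (p * T) ≤ (scoreSq x T p fun t => e t ω)
        - ∫ ω, scoreSq x T p (fun t => e t ω) ∂μ := by linarith
    exact hdev.trans (le_abs_self _)
  · rw [div_le_iff₀ (by positivity)]
    refine (variance_scoreSq_le he hk hx hT hspec).trans_eq ?_
    field_simp

end Deviation

namespace IsCausalProcess

variable {Ω : Type*} {mΩ : MeasurableSpace Ω} {μ : Measure Ω} {E : Type*} [NormedAddCommGroup E]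
  [MeasurableSpace E] [BorelSpace E] [SecondCountableTopology E] [IsProbabilityMeasure μ]
  {G : ℤ → (ℤ → E) → ℝ} {Y : ℤ → Ω → E} {c K : ℝ} {x : ℕ → ℕ → ℝ} {B C b : ℝ}

theorem aemeasurable_centred (hP : IsCausalProcess μ G Y c K) (t : ℤ) :
    AEMeasurable (centred μ fun ω => G t fun τ => Y τ ω) μ :=
  aemeasurable_of_tendsto_metrizable_ae atTop
    (fun k => ((hP.measurable_truncEval k _ t).sub_const _).aemeasurable)
    (hP.ae_tendsto_centred_truncApprox t)

theorem meas_le_scoreSq_le (hP : IsCausalProcess μ G Y c K) (hx : ∀ t j, |x t j| ≤ B) (hC : 0 < C)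
    (hBC : 64 * B ^ 2 * (c * √K) ^ 2 ≤ C) (k : ℕ) {T p : ℕ} (hT : 1 ≤ T) (hp : 1 ≤ p)
    (hspec : ∀ κ ∈ spectrum ℝ (gramMatrix x T p), |κ| ≤ b) :
    μ {ω | 8 * C * (p * T) ≤ scoreSq x T p fun t => centred μ (fun ω => G t fun τ => Y τ ω) ω}
      ≤ ENNReal.ofReal ((4 * c * (k + 1)) ^ 4 / C ^ 2 * (2 * (2 * k + 1) ^ 2 * b ^ 2 * (1 / p)
          + (6 * k + 1) ^ 2 * (6 * k + 1) * B ^ 4 * (1 / T)))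
        + ENNReal.ofReal (1 / ((k : ℝ) + 1)) := by
  have hT' : (0 : ℝ) < T := by exact_mod_cast hT
  have hp' : (0 : ℝ) < p := by exact_mod_cast hp
  rw [show 8 * C * (p * T) = 4 * (2 * C * (p * T)) by ring]
  refine (meas_le_scoreSq_le_add _ (fun t => centred μ (truncApprox G Y k t)) x T p _).trans
    (add_le_add ?_ ?_)
  · refine meas_le_scoreSq_le_of_kDependent (hP.isBoundedCentred_truncApprox k)
      (hP.kDependent_truncApprox k) hC (fun j => ?_) hx hT hp hspec
    exact (hP.lintegral_sum_mul_centred_truncApprox_le k (fun t => hx t j) T).trans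
      (ENNReal.ofReal_le_ofReal (by gcongr))
  · refine (_root_.meas_le_scoreSq_le (C := C / (k + 1))
      (fun t => (hP.aemeasurable_centred t).sub
        ((hP.measurable_truncEval k _ t).sub_const _).aemeasurable) (fun j => ?_) p
      (by positivity)).trans (ENNReal.ofReal_le_ofReal ?_)
    · exact (hP.lintegral_sum_mul_centred_sub_truncApprox_le k (fun t => hx t j) T).trans
        (ENNReal.ofReal_le_ofReal (by gcongr))
    · have hk : (0 : ℝ) < k + 1 := by positivity
      field_simp
      norm_num

theorem tendsto_meas_le_scoreSq (hP : IsCausalProcess μ G Y c K) (hx : ∀ t j, |x t j| ≤ B)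
    (hC : 0 < C) (hBC : 64 * B ^ 2 * (c * √K) ^ 2 ≤ C) {T p : ℕ → ℕ} (hT : Tendsto T atTop atTop)
    (hp : Tendsto p atTop atTop)
    (hspec : ∀ n, ∀ κ ∈ spectrum ℝ (gramMatrix x (T n) (p n)), |κ| ≤ b) :
    Tendsto (fun n => μ {ω | 8 * C * (p n * T n)
      ≤ scoreSq x (T n) (p n) fun t => centred μ (fun ω => G t fun τ => Y τ ω) ω}) atTop (𝓝 0) := by
  have hinv : ∀ {m : ℕ → ℕ}, Tendsto m atTop atTop →
      Tendsto (fun n => (1 : ℝ) / m n) atTop (𝓝 0) := fun hm => by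
    simpa only [one_div, Function.comp_def] using
      tendsto_inv_atTop_zero.comp (tendsto_natCast_atTop_atTop.comp hm)
  refine ENNReal.tendsto_nhds_zero.2 fun δ hδ => ?_
  have htrunc := ENNReal.tendsto_ofReal (tendsto_one_div_add_atTop_nhds_zero_nat (𝕜 := ℝ))
  rw [ENNReal.ofReal_zero] at htrunc
  obtain ⟨k, hk⟩ := (htrunc.eventually_le_const (ENNReal.half_pos hδ.ne')).exists
  have hlimp := (hinv hp).const_mul (2 * (2 * (k : ℝ) + 1) ^ 2 * b ^ 2)
  have hlimT := (hinv hT).const_mul ((6 * (k : ℝ) + 1) ^ 2 * (6 * k + 1) * B ^ 4)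
  have hconc := ENNReal.tendsto_ofReal
    ((hlimp.add hlimT).const_mul ((4 * c * (k + 1)) ^ 4 / C ^ 2))
  simp only [mul_zero, add_zero, ENNReal.ofReal_zero] at hconc
  filter_upwards [hconc.eventually_le_const (ENNReal.half_pos hδ.ne'), hT.eventually_ge_atTop 1,
    hp.eventually_ge_atTop 1] with n hn hTn hpn
  exact (hP.meas_le_scoreSq_le hx hC hBC k hTn hpn (hspec n)).trans
    ((add_le_add hn hk).trans_eq (ENNReal.add_halves δ))

end IsCausalProcess

/-! ### The error model as a causal process -/

section Blocks

variable {Ω : Type*} {mΩ : MeasurableSpace Ω} {μ : Measure Ω} {ι κ : Type*}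

theorem iIndep_iSup_preimage {m : κ → MeasurableSpace Ω} (hm : ∀ k, m k ≤ mΩ) (h : iIndep m μ)
    (f : κ → ι) : iIndep (fun i => ⨆ k ∈ f ⁻¹' {i}, m k) μ := by
  classical
  have : IsProbabilityMeasure μ := h.isProbabilityMeasure
  refine (iIndep_iff _ μ).2 fun s => ?_
  induction s using Finset.induction with
  | empty => simp
  | insert i s his ih =>
    intro A hA
    have hsplit : Indep (⨆ k ∈ f ⁻¹' {i}, m k) (⨆ k ∈ f ⁻¹' s, m k) μ :=
      indep_iSup_of_disjoint hm h ((Set.disjoint_singleton_left.2 his).preimage f)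
    have hfiber_le : ∀ j ∈ s, ⨆ k ∈ f ⁻¹' {j}, m k ≤ ⨆ k ∈ f ⁻¹' s, m k := fun j hj =>
      biSup_mono fun _ hk => Set.preimage_mono (Set.singleton_subset_iff.2 hj) hk
    have hrest : MeasurableSet[⨆ k ∈ f ⁻¹' s, m k] (⋂ j ∈ s, A j) :=
      Finset.measurableSet_biInter (m := ⨆ k ∈ f ⁻¹' s, m k) s fun j hj =>
        hfiber_le j hj _ (hA j (Finset.mem_insert_of_mem hj))
    rw [Finset.set_biInter_insert, Finset.prod_insert his,
      (Indep_iff _ _ μ).1 hsplit _ _ (hA i (Finset.mem_insert_self i s)) hrest,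
      ih fun j hj => hA j (Finset.mem_insert_of_mem hj)]

theorem iIndepFun_curry {E : Type*} [MeasurableSpace E] {X : κ → ι → Ω → E}
    (hX : ∀ k i, Measurable (X k i)) (h : iIndepFun (fun k : κ × ι => X k.1 k.2) μ) :
    iIndepFun (fun i ω k => X k i ω) μ := by
  have hblocks := iIndep_iSup_preimage (fun k => (hX k.1 k.2).comap_le) h.iIndep Prod.snd
  refine (iIndepFun_iff_iIndep _ _ _).2 (iIndep_of_iIndep_of_le hblocks fun i => ?_)
  rw [MeasurableSpace.pi, MeasurableSpace.comap_iSup]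
  refine iSup_le fun k => ?_
  rw [MeasurableSpace.comap_comp]
  exact le_iSup₂ (f := fun (p : κ × ι) (_ : p ∈ Prod.snd ⁻¹' {i}) =>
    MeasurableSpace.comap (X p.1 p.2) inferInstance) (k, i) rfl

end Blocks

theorem lagWeight_le_mul_lagWeight_add {m i : ℕ} (hi : i ≤ m) (j : ℕ) :
    lagWeight j ≤ ((m : ℝ) + 1) ^ 4 * lagWeight (i + j) := by
  have hi' : (i : ℝ) ≤ m := by exact_mod_cast hi
  have hlag : ((i + j : ℕ) : ℝ) + 1 ≤ (m + 1) * (j + 1) := by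
    push_cast
    nlinarith [mul_nonneg (Nat.cast_nonneg m : (0 : ℝ) ≤ m) (Nat.cast_nonneg j : (0 : ℝ) ≤ j)]
  rw [lagWeight, lagWeight, mul_one_div, div_le_div_iff₀ (by positivity) (by positivity), one_mul,
    ← mul_pow]
  exact pow_le_pow_left₀ (by positivity) hlag 4

theorem max_one_rpow_le_lagWeight {r : ℝ} (hr : r ≤ -4) (j : ℕ) :
    (max (j : ℝ) 1) ^ r ≤ 16 * lagWeight j := by
  have hmax : (1 : ℝ) ≤ max (j : ℝ) 1 := le_max_right _ _
  have hle : (j : ℝ) + 1 ≤ 2 * max (j : ℝ) 1 := by linarith [le_max_left (j : ℝ) 1]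
  calc (max (j : ℝ) 1) ^ r ≤ (max (j : ℝ) 1) ^ (-(4 : ℕ) : ℝ) :=
        Real.rpow_le_rpow_of_exponent_le hmax (by exact_mod_cast hr)
    _ = 16 / (2 * max (j : ℝ) 1) ^ 4 := by
        rw [Real.rpow_neg (by positivity), Real.rpow_natCast]
        field_simp
        norm_num
    _ ≤ 16 / ((j : ℝ) + 1) ^ 4 := by gcongr
    _ = 16 * lagWeight j := by rw [lagWeight, mul_one_div]

theorem tsum_lagWeight_mul_shift_le {m i : ℕ} (hi : i ≤ m) {f : ℕ → ℝ} (hf : ∀ h, 0 ≤ f h)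
    (hsum : Summable fun h => lagWeight h * f h) :
    (Summable fun j => lagWeight j * f (i + j)) ∧
      ∑' j, lagWeight j * f (i + j) ≤ ((m : ℝ) + 1) ^ 4 * ∑' h, lagWeight h * f h := by
  have hinj : Function.Injective fun j : ℕ => i + j := add_right_injective i
  have hshift := (hsum.comp_injective hinj).mul_left (((m : ℝ) + 1) ^ 4)
  have hle : ∀ j, lagWeight j * f (i + j)
      ≤ ((m : ℝ) + 1) ^ 4 * (lagWeight (i + j) * f (i + j)) := fun j => by
    rw [← mul_assoc]
    exact mul_le_mul_of_nonneg_right (lagWeight_le_mul_lagWeight_add hi j) (hf _)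
  have hsummable : Summable fun j => lagWeight j * f (i + j) :=
    hshift.of_nonneg_of_le (fun j => mul_nonneg (lagWeight_nonneg j) (hf _)) hle
  refine ⟨hsummable, (hsummable.tsum_le_tsum hle hshift).trans ?_⟩
  rw [tsum_mul_left]
  exact mul_le_mul_of_nonneg_left (tsum_comp_le_tsum_of_inj hsum
    (fun h => mul_nonneg (lagWeight_nonneg h) (hf h)) hinj) (by positivity)

theorem summable_lagWeight_mul_norm_sub {E : Type*} [NormedAddCommGroup E] {t : ℤ} {y y' : ℤ → E}
    (hy : HasSummablePast t y) (hy' : HasSummablePast t y') :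
    Summable fun h : ℕ => lagWeight h * ‖y (t - h) - y' (t - h)‖ :=
  (hy.add hy').of_nonneg_of_le (fun h => mul_nonneg (lagWeight_nonneg h) (norm_nonneg _))
    fun h => by
      rw [← mul_add]
      exact mul_le_mul_of_nonneg_left (norm_sub_le _ _) (lagWeight_nonneg h)

theorem abs_mulVec_le {n : Type*} [Fintype n] {A : Matrix n n ℝ} {a : ℝ} (hA : ∀ i j, |A i j| ≤ a)
    (v : n → ℝ) (i : n) : |(A *ᵥ v) i| ≤ Fintype.card n * a * ‖v‖ :=
  calc |(A *ᵥ v) i| ≤ ∑ j, |A i j * v j| := Finset.abs_sum_le_sum_abs _ _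
    _ ≤ ∑ _j : n, a * ‖v‖ := Finset.sum_le_sum fun j _ => by
        rw [abs_mul]
        exact mul_le_mul (hA i j) (norm_le_pi_norm v j) (abs_nonneg _)
          ((abs_nonneg _).trans (hA i j))
    _ = Fintype.card n * a * ‖v‖ := by
        rw [Finset.sum_const, Finset.card_univ, nsmul_eq_mul, mul_assoc]

theorem norm_pow_le_sum_norm_pow {ι E : Type*} [Fintype ι] [NormedAddCommGroup E] (v : ι → E)
    {n : ℕ} (hn : n ≠ 0) : ‖v‖ ^ n ≤ ∑ i, ‖v i‖ ^ n := by
  rcases isEmpty_or_nonempty ι with hι | hι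
  · simp [Subsingleton.elim v 0, hn]
  · obtain ⟨i, hi⟩ := Finite.exists_max fun i => ‖v i‖
    calc ‖v‖ ^ n ≤ ‖v i‖ ^ n := by
          gcongr
          exact (pi_norm_le_iff_of_nonneg (norm_nonneg _)).2 hi
      _ ≤ ∑ i, ‖v i‖ ^ n :=
          Finset.single_le_sum (f := fun i => ‖v i‖ ^ n)
            (fun _ _ => pow_nonneg (norm_nonneg _) n) (Finset.mem_univ i)

theorem integrable_norm_pow_and_integral_le_of_lintegral_le {Ω E : Type*} [MeasurableSpace Ω]
    {μ : Measure Ω} [NormedAddCommGroup E] {X : Ω → E} (hX : AEStronglyMeasurable X μ) {n : ℕ}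
    {K : ℝ} (h : ∫⁻ ω, ‖X ω‖ₑ ^ n ∂μ ≤ ENNReal.ofReal K) :
    Integrable (fun ω => ‖X ω‖ ^ n) μ ∧ ∫ ω, ‖X ω‖ ^ n ∂μ ≤ max K 0 := by
  have hofReal : ∀ ω, ENNReal.ofReal (‖X ω‖ ^ n) = ‖X ω‖ₑ ^ n := fun ω => by
    rw [ENNReal.ofReal_pow (norm_nonneg _), ofReal_norm]
  have hnonneg : 0 ≤ᵐ[μ] fun ω => ‖X ω‖ ^ n := ae_of_all _ fun _ => pow_nonneg (norm_nonneg _) n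
  have hmeas : AEStronglyMeasurable (fun ω => ‖X ω‖ ^ n) μ := hX.norm.pow n
  refine ⟨⟨hmeas, ?_⟩, ?_⟩
  · rw [hasFiniteIntegral_iff_ofReal hnonneg]
    simp_rw [hofReal]
    exact h.trans_lt ENNReal.ofReal_lt_top
  · rw [integral_eq_lintegral_of_nonneg_ae hnonneg hmeas, ← ENNReal.toReal_ofReal']
    simp_rw [hofReal]
    exact ENNReal.toReal_mono ENNReal.ofReal_ne_top h

namespace ErrorModel

variable {d L m q : ℕ} {Ω : Type*}

/-- The error model with the innovation sequence itself as sample point: `y τ ℓ` is the innovation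
of the `ℓ`-th linear process at time `τ`. -/
def canonical (M : ErrorModel d L m q Ω) : ErrorModel d L m q (ℤ → Fin (L + 1) → Fin d → ℝ) where
  innov ℓ τ y := y τ ℓ
  coef := M.coef
  load := M.load
  weight := M.weight
  source := M.source
  pos := M.pos
  H := M.H

/-- The error before centring, as a functional of the innovation sequence. -/
noncomputable def functional (M : ErrorModel d L m q Ω) (ν : Fin d) (t : ℤ)
    (y : ℤ → Fin (L + 1) → Fin d → ℝ) : ℝ :=
  M.H (M.canonical.lagged t y) ν

variable {M : ErrorModel d L m q Ω} {C A : ℝ} {t : ℤ} {y y' : ℤ → Fin (L + 1) → Fin d → ℝ}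

theorem abs_linProc_sub_le (hC : 0 ≤ C) (hcoef : ∀ ℓ j ν κ, |M.coef ℓ j ν κ| ≤ C * lagWeight j)
    (hy : HasSummablePast t y) (hy' : HasSummablePast t y') (ℓ : Fin (L + 1)) {i : ℕ}
    (hi : i ≤ m) (ν : Fin d) :
    |M.canonical.linProc ℓ (t - i) y ν - M.canonical.linProc ℓ (t - i) y' ν|
      ≤ d * C * (m + 1) ^ 4 * ∑' h : ℕ, lagWeight h * ‖y (t - h) - y' (t - h)‖ := by
  have hterm : ∀ (z : ℤ → Fin (L + 1) → Fin d → ℝ) (j : ℕ), ‖(M.coef ℓ j *ᵥ z (t - i - j) ℓ) ν‖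
      ≤ d * C * (lagWeight j * ‖z (t - (i + j : ℕ))‖) := fun z j => by
    rw [show t - i - j = t - (i + j : ℕ) by push_cast; ring]
    have hmulVec := abs_mulVec_le (hcoef ℓ j) (z (t - (i + j : ℕ)) ℓ) ν
    rw [Fintype.card_fin, ← mul_assoc, mul_assoc _ (lagWeight j)] at hmulVec
    refine hmulVec.trans (mul_le_mul_of_nonneg_left ?_ (by positivity))
    exact mul_le_mul_of_nonneg_left (norm_le_pi_norm _ ℓ) (lagWeight_nonneg j)
  have hsummable : ∀ z : ℤ → Fin (L + 1) → Fin d → ℝ, HasSummablePast t z →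
      Summable fun j : ℕ => (M.coef ℓ j *ᵥ z (t - i - j) ℓ) ν := fun z hz =>
    .of_norm_bounded ((tsum_lagWeight_mul_shift_le hi (f := fun h => ‖z (t - h)‖)
      (fun _ => norm_nonneg _) hz).1.mul_left _) (hterm z)
  obtain ⟨hshift, hshift_le⟩ := tsum_lagWeight_mul_shift_le hi
    (f := fun h => ‖y (t - h) - y' (t - h)‖) (fun _ => norm_nonneg _)
    (summable_lagWeight_mul_norm_sub hy hy')
  calc |M.canonical.linProc ℓ (t - i) y ν - M.canonical.linProc ℓ (t - i) y' ν|
      = ‖∑' j : ℕ, (M.coef ℓ j *ᵥ (y - y') (t - i - j) ℓ) ν‖ := by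
        simp_rw [Pi.sub_apply, Matrix.mulVec_sub, Pi.sub_apply]
        rw [(hsummable y hy).tsum_sub (hsummable y' hy')]
        rfl
    _ ≤ ∑' j : ℕ, d * C * (lagWeight j * ‖(y - y') (t - (i + j : ℕ))‖) :=
        tsum_of_norm_bounded (hshift.mul_left _).hasSum (hterm (y - y'))
    _ ≤ _ := by
        rw [tsum_mul_left, mul_assoc (d * C)]
        exact mul_le_mul_of_nonneg_left hshift_le (by positivity)

theorem abs_field_sub_le {s : Fin q → ℝ} (hA : ∀ ℓ ν,
      |M.canonical.linProc ℓ t y ν - M.canonical.linProc ℓ t y' ν| ≤ A)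
    (hweight : ∀ ℓ, M.weight s (M.source ℓ) ∈ Set.Icc 0 1) (ν : Fin d) :
    |M.canonical.field s t y ν - M.canonical.field s t y' ν|
      ≤ (∑ ℓ, |M.load ν ℓ| + 1) * A := by
  have hfactor : ∀ ℓ : Fin L, |M.load ν ℓ * M.weight s (M.source ℓ)
      * (M.canonical.linProc ℓ.succ t y ν - M.canonical.linProc ℓ.succ t y' ν)|
        ≤ |M.load ν ℓ| * A := fun ℓ => by
    rw [abs_mul, abs_mul, abs_of_nonneg (hweight ℓ).1]
    exact mul_le_mul (mul_le_of_le_one_right (abs_nonneg _) (hweight ℓ).2) (hA ℓ.succ ν)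
      (abs_nonneg _) (abs_nonneg _)
  calc _ = |∑ ℓ : Fin L, M.load ν ℓ * M.weight s (M.source ℓ)
            * (M.canonical.linProc ℓ.succ t y ν - M.canonical.linProc ℓ.succ t y' ν)
          + (M.canonical.linProc 0 t y ν - M.canonical.linProc 0 t y' ν)| := by
        simp_rw [mul_sub, Finset.sum_sub_distrib]
        rw [← add_sub_add_comm]
        rfl
    _ ≤ ∑ ℓ, |M.load ν ℓ| * A + A :=
        (abs_add_le _ _).trans (add_le_add ((Finset.abs_sum_le_sum_abs _ _).trans
          (Finset.sum_le_sum fun ℓ _ => hfactor ℓ)) (hA 0 ν))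
    _ = (∑ ℓ, |M.load ν ℓ| + 1) * A := by rw [← Finset.sum_mul, add_mul, one_mul]

variable [MeasurableSpace Ω] {μ : Measure Ω}

theorem Assumptions.exists_abs_coef_le (hM : M.Assumptions μ) :
    ∃ C, 0 ≤ C ∧ ∀ ℓ j ν κ, |M.coef ℓ j ν κ| ≤ C * lagWeight j := by
  obtain ⟨C, θ, hθ, hdecay⟩ := hM.decay
  refine ⟨|C| * 16, by positivity, fun ℓ j ν κ => (hdecay ℓ j ν κ).trans ?_⟩
  rw [mul_assoc]
  exact mul_le_mul (le_abs_self C) (max_one_rpow_le_lagWeight (by linarith) j)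
    (by positivity) (abs_nonneg C)

theorem Assumptions.exists_abs_lagged_sub_le (hM : M.Assumptions μ) :
    ∃ A, 0 ≤ A ∧ ∀ t y y', HasSummablePast t y → HasSummablePast t y' → ∀ i κ,
      |M.canonical.lagged t y i κ - M.canonical.lagged t y' i κ|
        ≤ A * ∑' h : ℕ, lagWeight h * ‖y (t - h) - y' (t - h)‖ := by
  obtain ⟨C, hC, hcoef⟩ := hM.exists_abs_coef_le
  set Φ : ℝ := ∑ κ, ∑ ℓ, |M.load κ ℓ|
  refine ⟨(Φ + 1) * (d * C * (m + 1) ^ 4), by positivity, fun t y y' hy hy' i κ => ?_⟩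
  have hfield := abs_field_sub_le (M := M) (s := M.pos t i)
    (fun ℓ κ => abs_linProc_sub_le hC hcoef hy hy' ℓ i.is_le κ)
    (fun ℓ => hM.weight_ok.1 _ (hM.pos_mem t i) _ (hM.source_mem ℓ)) κ
  refine hfield.trans ?_
  rw [mul_assoc (Φ + 1)]
  refine mul_le_mul_of_nonneg_right (add_le_add_left ?_ 1) ?_
  · exact Finset.single_le_sum (f := fun κ => ∑ ℓ, |M.load κ ℓ|)
      (fun _ _ => Finset.sum_nonneg fun _ _ => abs_nonneg _) (Finset.mem_univ κ)
  · exact mul_nonneg (by positivity)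
      (tsum_nonneg fun h => mul_nonneg (lagWeight_nonneg h) (norm_nonneg _))

theorem Assumptions.exists_isCausalLipschitz (hM : M.Assumptions μ) (ν : Fin d) :
    ∃ c, IsCausalLipschitz c (M.functional ν) := by
  obtain ⟨A, hA, hlagged⟩ := hM.exists_abs_lagged_sub_le
  obtain ⟨LH, hLH⟩ := hM.lipschitz
  refine ⟨|LH| * (√((m + 1) * d) * A), by positivity, fun t y y' hy hy' => ?_⟩
  set S : ℝ := ∑' h : ℕ, lagWeight h * ‖y (t - h) - y' (t - h)‖
  have hS : 0 ≤ S := tsum_nonneg fun h => mul_nonneg (lagWeight_nonneg h) (norm_nonneg _)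
  have hsq : ∑ i, ∑ κ, (M.canonical.lagged t y i κ - M.canonical.lagged t y' i κ) ^ 2
      ≤ (m + 1) * d * (A * S) ^ 2 :=
    calc _ ≤ ∑ _i : Fin (m + 1), ∑ _κ : Fin d, (A * S) ^ 2 :=
          Finset.sum_le_sum fun i _ => Finset.sum_le_sum fun κ _ =>
            sq_le_sq' (abs_le.1 (hlagged t y y' hy hy' i κ)).1
              (abs_le.1 (hlagged t y y' hy hy' i κ)).2
      _ = (m + 1) * d * (A * S) ^ 2 := by simp [mul_assoc]
  calc |M.functional ν t y - M.functional ν t y'|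
      ≤ |LH| * √(∑ i, ∑ κ, (M.canonical.lagged t y i κ - M.canonical.lagged t y' i κ) ^ 2) :=
        (hLH ν _ _).trans (mul_le_mul_of_nonneg_right (le_abs_self _) (Real.sqrt_nonneg _))
    _ ≤ |LH| * √((m + 1) * d * (A * S) ^ 2) := by gcongr
    _ = |LH| * (√((m + 1) * d) * A) * S := by
        rw [Real.sqrt_mul (by positivity), Real.sqrt_sq (by positivity)]
        ring

theorem Assumptions.exists_integral_norm_pow_le (hM : M.Assumptions μ) :
    ∃ K : ℝ, ∀ τ, Integrable (fun ω => ‖fun ℓ => M.innov ℓ τ ω‖ ^ 4) μ ∧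
      ∫ ω, ‖fun ℓ => M.innov ℓ τ ω‖ ^ 4 ∂μ ≤ K := by
  obtain ⟨K, hK⟩ := hM.fourth_moment
  have hcoord : ∀ ℓ τ ν, Measurable fun ω => M.innov ℓ τ ω ν := fun ℓ τ ν =>
    (measurable_pi_apply ν).comp (hM.measurable_innov ℓ τ)
  have hmoment := fun ℓ τ ν => integrable_norm_pow_and_integral_le_of_lintegral_le
    (hcoord ℓ τ ν).aestronglyMeasurable (hK ℓ τ ν)
  have hint : ∀ τ, Integrable (fun ω => ∑ ℓ, ∑ ν, ‖M.innov ℓ τ ω ν‖ ^ 4) μ := fun τ =>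
    integrable_finsetSum _ fun ℓ _ => integrable_finsetSum _ fun ν _ => (hmoment ℓ τ ν).1
  have hle : ∀ τ ω, ‖fun ℓ => M.innov ℓ τ ω‖ ^ 4 ≤ ∑ ℓ, ∑ ν, ‖M.innov ℓ τ ω ν‖ ^ 4 := fun τ ω =>
    (norm_pow_le_sum_norm_pow _ four_ne_zero).trans
      (Finset.sum_le_sum fun ℓ _ => norm_pow_le_sum_norm_pow _ four_ne_zero)
  have hY : ∀ τ, Integrable (fun ω => ‖fun ℓ => M.innov ℓ τ ω‖ ^ 4) μ := fun τ =>
    (hint τ).mono' (((measurable_pi_lambda _ fun ℓ => hM.measurable_innov ℓ τ).norm.pow_const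
      4).aestronglyMeasurable) (ae_of_all _ fun ω => by
        rw [norm_pow, norm_norm]
        exact hle τ ω)
  refine ⟨∑ _ℓ : Fin (L + 1), ∑ _ν : Fin d, max K 0, fun τ => ⟨hY τ, ?_⟩⟩
  refine (integral_mono (hY τ) (hint τ) (hle τ)).trans ?_
  rw [integral_finsetSum _ fun ℓ _ => integrable_finsetSum _ fun ν _ => (hmoment ℓ τ ν).1]
  refine Finset.sum_le_sum fun ℓ _ => ?_
  rw [integral_finsetSum _ fun ν _ => (hmoment ℓ τ ν).1]
  exact Finset.sum_le_sum fun ν _ => (hmoment ℓ τ ν).2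

theorem Assumptions.exists_isCausalProcess (hM : M.Assumptions μ) (ν : Fin d) :
    ∃ c K, IsCausalProcess μ (M.functional ν) (fun τ ω ℓ => M.innov ℓ τ ω) c K := by
  obtain ⟨c, hc⟩ := hM.exists_isCausalLipschitz ν
  obtain ⟨K, hK⟩ := hM.exists_integral_norm_pow_le
  exact ⟨c, max K 1, {
    lipschitz := hc
    measurable := fun τ => measurable_pi_lambda _ fun ℓ => hM.measurable_innov ℓ τ
    indep := iIndepFun_curry hM.measurable_innov hM.indep
    integrable_norm_pow := fun τ => (hK τ).1
    integral_norm_pow_le := fun τ => (hK τ).2.trans (le_max_left _ _)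
    one_le := le_max_right _ _ }⟩

end ErrorModel

/-! ### Penalized least squares with random errors -/

theorem regParam_nonneg (C α : ℝ) (T p : ℕ) : 0 ≤ regParam C α T p :=
  mul_nonneg (Real.sqrt_nonneg _) (Real.sqrt_nonneg _)

theorem sq_mul_regParam {C α : ℝ} (hC : 0 ≤ C) (hα : 0 < α) {T : ℕ} (hT : 1 ≤ T) (p : ℕ) :
    (T * regParam C α T p) ^ 2 = C / α * (p * T) := by
  have hT' : (0 : ℝ) < T := by exact_mod_cast hT
  rw [regParam, mul_pow, mul_pow, Real.sq_sqrt (by positivity), Real.sq_sqrt (by positivity)]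
  field_simp

theorem tendsto_regParam_zero (C α : ℝ) {T p : ℕ → ℕ}
    (hpT : (fun n => (p n : ℝ)) =o[atTop] fun n => (T n : ℝ)) :
    Tendsto (fun n => regParam C α (T n) (p n)) atTop (𝓝 0) := by
  simpa [regParam] using hpT.tendsto_div_nhds_zero.sqrt.const_mul √(C / α)

theorem tendsto_mul_zero_of_isLittleO_inv {f g : ℕ → ℝ} (h : g =o[atTop] fun n => (f n)⁻¹) :
    Tendsto (fun n => f n * g n) atTop (𝓝 0) := by
  have hbound : (fun n => f n * (f n)⁻¹) =O[atTop] fun _ => (1 : ℝ) :=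
    Asymptotics.IsBigO.of_bound 1 (Eventually.of_forall fun n => by
      rcases eq_or_ne (f n) 0 with hf | hf <;> simp [hf])
  exact (Asymptotics.isLittleO_one_iff ℝ).1
    (((Asymptotics.isBigO_refl f atTop).mul_isLittleO h).trans_isBigO hbound)

theorem mul_le_sq_mul_regParam {C Cν α : ℝ} (hC : 0 ≤ C) (hCν : C ≤ Cν) (hα : α ∈ Set.Ioc 0 1)
    {T : ℕ} (hT : 1 ≤ T) (p : ℕ) : C * (p * T) ≤ (T * regParam Cν α T p) ^ 2 := by
  rw [sq_mul_regParam (hC.trans hCν) hα.1 hT]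
  have hdiv : C ≤ Cν / α :=
    (le_div_iff₀ hα.1).2 ((mul_le_of_le_one_right hC hα.2).trans hCν)
  gcongr

section RandomErrors

variable {Ω : Type*} {mΩ : MeasurableSpace Ω} {μ : Measure Ω} {e : ℤ → Ω → ℝ} {x : ℕ → ℕ → ℝ}
  {C s : ℝ}

theorem tendstoInMeasure_zero_of_nonneg {f : ℕ → Ω → ℝ} (hf : ∀ n ω, 0 ≤ f n ω)
    (h : ∀ ε : ℝ, 0 < ε → Tendsto (fun n => μ {ω | ε ≤ f n ω}) atTop (𝓝 0)) :
    TendstoInMeasure μ f atTop (fun _ => (0 : ℝ)) := by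
  refine tendstoInMeasure_iff_norm.2 fun ε hε => ?_
  simpa only [sub_zero, Real.norm_eq_abs, abs_of_nonneg (hf _ _)] using h ε hε

namespace IsPenalizedLSE

theorem meas_not_sampleMSPE_le_le {T p : ℕ} {β : Fin p → ℝ} {α Cν : ℝ} {bhat : Ω → Fin p → ℝ}
    (hbhat : IsPenalizedLSE x T p β e (regParam Cν α T p) s bhat)
    (he : ∀ t : ℕ, AEMeasurable (e t) μ)
    (hmoment : ∀ j, ∫⁻ ω, ‖score x T (fun t => e t ω) j‖ₑ ^ 2 ∂μ ≤ ENNReal.ofReal (C * T))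
    (hT : 1 ≤ T) (hp : 1 ≤ p) (hs : s ∈ Set.Icc (1 : ℝ) 2) (hα : 0 < α) (hCν : 0 < Cν)
    (hC : 4 * C ≤ Cν) :
    μ {ω | ¬ sampleMSPE x T p β (bhat ω) ≤ 2 * regParam Cν α T p * lsNorm s β}
      ≤ ENNReal.ofReal α := by
  have hT' : (0 : ℝ) < T := by exact_mod_cast hT
  have hp' : (0 : ℝ) < p := by exact_mod_cast hp
  have hscore : {ω | ¬ sampleMSPE x T p β (bhat ω) ≤ 2 * regParam Cν α T p * lsNorm s β}
      ⊆ {ω | Cν / α * (p * T) / 4 ≤ scoreSq x T p fun t => e t ω} := fun ω hω => by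
    by_contra hlt
    refine hω (sampleMSPE_le_of_scoreSq_le hT (regParam_nonneg _ _ _ _) hs (hbhat ω) ?_)
    have hlt' : scoreSq x T p (fun t => e t ω) < Cν / α * (p * T) / 4 := not_le.1 hlt
    rw [sq_mul_regParam hCν.le hα hT]
    linarith
  refine (measure_mono hscore).trans ((meas_le_scoreSq_le he hmoment p (by positivity)).trans
    (ENNReal.ofReal_le_ofReal ?_))
  rw [show C * (p * T) / (Cν / α * (p * T) / 4) = α * (4 * C / Cν) by field_simp]
  exact mul_le_of_le_one_right hα.le ((div_le_one hCν).2 hC)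

variable {T p : ℕ → ℕ} {β : ∀ n, Fin (p n) → ℝ} {lam : ℕ → ℝ} {bhat : ∀ n, Ω → Fin (p n) → ℝ}

theorem tendstoInMeasure_sampleMSPE_of_isLittleO {a : ℝ}
    (hbhat : ∀ n, IsPenalizedLSE x (T n) (p n) (β n) e (lam n) s (bhat n))
    (he : ∀ t : ℕ, AEMeasurable (e t) μ)
    (hmoment : ∀ N j, ∫⁻ ω, ‖score x N (fun t => e t ω) j‖ₑ ^ 2 ∂μ ≤ ENNReal.ofReal (C * N))
    (hT : ∀ n, 1 ≤ T n) (ha : 0 < a)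
    (hspec : ∀ n, ∀ κ ∈ spectrum ℝ (gramMatrix x (T n) (p n)), a ≤ κ) (hlam : ∀ n, 0 ≤ lam n)
    (hpT : (fun n => (p n : ℝ)) =o[atTop] fun n => (T n : ℝ))
    (hpen : Tendsto (fun n => lam n * lsNorm s (β n)) atTop (𝓝 0)) :
    TendstoInMeasure μ (fun n ω => sampleMSPE x (T n) (p n) (β n) (bhat n ω)) atTop
      (fun _ => (0 : ℝ)) := by
  refine tendstoInMeasure_zero_of_nonneg (fun n ω => sampleMSPE_nonneg _ _ _ _ _) fun ε hε => ?_
  have hscore : ∀ n, lam n * lsNorm s (β n) < ε / 4 →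
      {ω | ε ≤ sampleMSPE x (T n) (p n) (β n) (bhat n ω)}
        ⊆ {ω | a * T n ^ 2 * ε / 8 ≤ scoreSq x (T n) (p n) fun t => e t ω} :=
    fun n hn ω (hω : ε ≤ _) => by
      have hT' : (0 : ℝ) < T n := by exact_mod_cast hT n
      have hmspe := sampleMSPE_le_add_of_lower_bound (hT n) (hlam n) ha (hbhat n ω)
        (mul_sum_sq_le_sampleMSPE (hspec n) _ _)
      have hquot : ε / 2 ≤ 4 * scoreSq x (T n) (p n) (fun t => e t ω) / (a * T n ^ 2) := by
        linarith
      rw [le_div_iff₀ (by positivity)] at hquot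
      exact show a * T n ^ 2 * ε / 8 ≤ scoreSq x (T n) (p n) (fun t => e t ω) by linarith
  have hmarkov := ENNReal.tendsto_ofReal
    (hpT.tendsto_div_nhds_zero.const_mul (8 * C / (a * ε)))
  rw [mul_zero, ENNReal.ofReal_zero] at hmarkov
  refine tendsto_of_tendsto_of_tendsto_of_le_of_le' tendsto_const_nhds hmarkov
    (Eventually.of_forall fun _ => zero_le) ?_
  filter_upwards [hpen.eventually_lt_const (show 0 < ε / 4 by positivity)] with n hn
  have hT' : (0 : ℝ) < T n := by exact_mod_cast hT n
  refine (measure_mono (hscore n hn)).trans ((meas_le_scoreSq_le he (hmoment _) (p n)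
    (by positivity)).trans_eq (congrArg ENNReal.ofReal ?_))
  field_simp

theorem tendstoInMeasure_sampleMSPE_of_tendsto_meas_le_scoreSq
    (hbhat : ∀ n, IsPenalizedLSE x (T n) (p n) (β n) e (lam n) s (bhat n)) (hT : ∀ n, 1 ≤ T n)
    (hs : s ∈ Set.Icc (1 : ℝ) 2) (hlam : ∀ n, 0 ≤ lam n)
    (hpen : Tendsto (fun n => lam n * lsNorm s (β n)) atTop (𝓝 0)) {a : ℕ → ℝ}
    (ha : ∀ n, 4 * a n ≤ (T n * lam n) ^ 2)
    (hscore : Tendsto (fun n => μ {ω | a n ≤ scoreSq x (T n) (p n) fun t => e t ω})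
      atTop (𝓝 0)) :
    TendstoInMeasure μ (fun n ω => sampleMSPE x (T n) (p n) (β n) (bhat n ω)) atTop
      (fun _ => (0 : ℝ)) := by
  refine tendstoInMeasure_zero_of_nonneg (fun n ω => sampleMSPE_nonneg _ _ _ _ _) fun ε hε => ?_
  refine tendsto_of_tendsto_of_tendsto_of_le_of_le' tendsto_const_nhds hscore
    (Eventually.of_forall fun _ => zero_le) ?_
  filter_upwards [hpen.eventually_lt_const (half_pos hε)] with n hn
  refine measure_mono fun ω (hω : ε ≤ _) => ?_
  by_contra hlt
  have hlt' : scoreSq x (T n) (p n) (fun t => e t ω) < a n := not_le.1 hlt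
  have hmspe := sampleMSPE_le_of_scoreSq_le (hT n) (hlam n) hs (hbhat n ω) (by linarith [ha n])
  linarith

end IsPenalizedLSE

end RandomErrors

theorem mainTheorem7_general {Ω : Type*} [MeasurableSpace Ω] {μ : Measure Ω}
    [IsProbabilityMeasure μ] {E : Type*} [NormedAddCommGroup E] [MeasurableSpace E] [BorelSpace E]
    [SecondCountableTopology E] {G : ℤ → (ℤ → E) → ℝ} {Y : ℤ → Ω → E} {c K : ℝ}
    (hP : IsCausalProcess μ G Y c K) {e : ℤ → Ω → ℝ}
    (he : ∀ t, e t = centred μ fun ω => G t fun τ => Y τ ω) {x : ℕ → ℕ → ℝ} {S : Set (ℕ × ℕ)}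
    (hpos : ∀ T p, (T, p) ∈ S → 1 ≤ T ∧ 1 ≤ p) (hbounded : ∃ B : ℝ, ∀ t j, |x t j| ≤ B)
    (hspec : ∃ a b : ℝ, 0 < a ∧ ∀ T p, (T, p) ∈ S →
      spectrum ℝ (gramMatrix x T p) ⊆ Set.Icc a b) :
    ∃ C₀ : ℝ, 0 < C₀ ∧ ∀ Cν : ℝ, C₀ ≤ Cν →
      (∀ N j : ℕ, ∫⁻ ω, ‖∑ t ∈ Finset.Icc 1 N, x t j * e t ω‖ₑ ^ 2 ∂μ
        ≤ ENNReal.ofReal (Cν * N)) ∧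
      (∀ α > 0, ∀ s ∈ Set.Icc (1 : ℝ) 2, ∀ T p : ℕ, (T, p) ∈ S →
        ∀ (β : Fin p → ℝ) (bhat : Ω → Fin p → ℝ),
          IsPenalizedLSE x T p β e (regParam Cν α T p) s bhat →
          μ {ω | ¬ sampleMSPE x T p β (bhat ω) ≤ 2 * regParam Cν α T p * lsNorm s β}
            ≤ ENNReal.ofReal α) ∧
      (∀ α > 0, ∀ s > 0, ∀ T p : ℕ → ℕ, (∀ n, (T n, p n) ∈ S) →
        ∀ (β : ∀ n, Fin (p n) → ℝ) (bhat : ∀ n, Ω → Fin (p n) → ℝ),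
          (∀ n, IsPenalizedLSE x (T n) (p n) (β n) e (regParam Cν α (T n) (p n)) s (bhat n)) →
          (fun n => (p n : ℝ)) =o[atTop] (fun n => (T n : ℝ)) →
          (fun n => lsNorm s (β n)) =O[atTop] (fun _ => (1 : ℝ)) →
          TendstoInMeasure μ (fun n ω => sampleMSPE x (T n) (p n) (β n) (bhat n ω)) atTop
            (fun _ => (0 : ℝ))) ∧
      (∀ α : ℕ → ℝ, (∀ n, α n ∈ Set.Ioc (0 : ℝ) 1) → ∀ s ∈ Set.Icc (1 : ℝ) 2, ∀ T p : ℕ → ℕ,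
        (∀ n, (T n, p n) ∈ S) → Tendsto T atTop atTop → Tendsto p atTop atTop →
        ∀ (β : ∀ n, Fin (p n) → ℝ) (bhat : ∀ n, Ω → Fin (p n) → ℝ),
          (∀ n, IsPenalizedLSE x (T n) (p n) (β n) e (regParam Cν (α n) (T n) (p n)) s (bhat n)) →
          (fun n => lsNorm s (β n)) =o[atTop] (fun n => (regParam Cν (α n) (T n) (p n))⁻¹) →
          TendstoInMeasure μ (fun n ω => sampleMSPE x (T n) (p n) (β n) (bhat n ω)) atTop
            (fun _ => (0 : ℝ))) := by
  obtain rfl : e = fun t => centred μ fun ω => G t fun τ => Y τ ω := funext he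
  obtain ⟨B, hB⟩ := hbounded
  obtain ⟨a, b, ha, hab⟩ := hspec
  set C : ℝ := 64 * B ^ 2 * (c * √K) ^ 2 + 1
  have hC : 0 < C := by positivity
  have hmoment : ∀ N j,
      ∫⁻ ω, ‖score x N (fun t => centred μ (fun ω => G t fun τ => Y τ ω) ω) j‖ₑ ^ 2 ∂μ
        ≤ ENNReal.ofReal (C * N) := fun N j =>
    (hP.lintegral_sum_mul_centred_le (fun t => hB t j) N).trans
      (ENNReal.ofReal_le_ofReal (by gcongr; exact (lt_add_one _).le))
  have hmeas := fun t : ℕ => hP.aemeasurable_centred t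
  refine ⟨32 * C, by positivity, fun Cν hCν => ⟨fun N j => ?_, ?_, ?_, ?_⟩⟩
  · exact (hmoment N j).trans (ENNReal.ofReal_le_ofReal (by gcongr; linarith))
  · intro α hα s hs T p hTp β bhat hbhat
    exact hbhat.meas_not_sampleMSPE_le_le hmeas (hmoment T) (hpos T p hTp).1 (hpos T p hTp).2 hs hα
      (by linarith) (by linarith)
  · intro α _ s _ T p hTp β bhat hbhat hpT hβ
    refine IsPenalizedLSE.tendstoInMeasure_sampleMSPE_of_isLittleO hbhat hmeas hmoment
      (fun n => (hpos _ _ (hTp n)).1) ha (fun n κ hκ => (hab _ _ (hTp n) hκ).1)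
      (fun n => regParam_nonneg _ _ _ _) hpT ?_
    have hlam := (Asymptotics.isLittleO_one_iff ℝ).2 (tendsto_regParam_zero Cν α hpT)
    simpa using hlam.mul_isBigO hβ
  · intro α hα s hs T p hTp hT hp β bhat hbhat hβ
    have hscore := hP.tendsto_meas_le_scoreSq hB hC (lt_add_one _).le hT hp (b := b)
      fun n κ hκ => by
        rw [abs_of_nonneg (ha.le.trans (hab _ _ (hTp n) hκ).1)]
        exact (hab _ _ (hTp n) hκ).2
    refine IsPenalizedLSE.tendstoInMeasure_sampleMSPE_of_tendsto_meas_le_scoreSq hbhat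
      (fun n => (hpos _ _ (hTp n)).1) hs (fun n => regParam_nonneg _ _ _ _)
      (tendsto_mul_zero_of_isLittleO_inv hβ) (fun n => ?_) hscore
    linarith [mul_le_sq_mul_regParam (by positivity) hCν (hα n) (hpos _ _ (hTp n)).1 (p n)]

theorem mainTheorem7 {Ω : Type*} [MeasurableSpace Ω] (μ : Measure Ω) [IsProbabilityMeasure μ]
    {d L m q : ℕ} (M : ErrorModel d L m q Ω) (hM : M.Assumptions μ)
    (x : ℕ → ℕ → ℝ) (S : Set (ℕ × ℕ)) (hx : RegressorAssumptions x S) (ν : Fin d) :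
    ∃ C₀ : ℝ, 0 < C₀ ∧ ∀ Cν : ℝ, C₀ ≤ Cν →
      -- growth of the second moments of the partial sums
      (∀ N j : ℕ, ∫⁻ ω, ‖∑ t ∈ Finset.Icc 1 N, x t j * M.err μ (t : ℤ) ω ν‖ₑ ^ 2 ∂μ
        ≤ ENNReal.ofReal (Cν * N)) ∧
      -- the bound for the sample prediction error
      (∀ α ∈ Set.Ioo (0 : ℝ) 1, ∀ s ∈ Set.Icc (1 : ℝ) 2, ∀ T p : ℕ, (T, p) ∈ S →
        ∀ (β : Fin p → ℝ) (bhat : Ω → Fin p → ℝ),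
          IsPenalizedLSE x T p β (fun t ω => M.err μ t ω ν) (regParam Cν α T p) s bhat →
          μ {ω | ¬ sampleMSPE x T p β (bhat ω) ≤ 2 * regParam Cν α T p * lsNorm s β}
            ≤ ENNReal.ofReal α) ∧
      -- consistency for `p = o(T)` and bounded `‖β‖_s`
      (∀ α ∈ Set.Ioo (0 : ℝ) 1, ∀ s ∈ Set.Icc (1 : ℝ) 2, ∀ T p : ℕ → ℕ,
        (∀ n, (T n, p n) ∈ S) → Tendsto T atTop atTop →
        ∀ (β : ∀ n, Fin (p n) → ℝ) (bhat : ∀ n, Ω → Fin (p n) → ℝ),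
          (∀ n, IsPenalizedLSE x (T n) (p n) (β n) (fun t ω => M.err μ t ω ν)
            (regParam Cν α (T n) (p n)) s (bhat n)) →
          (fun n => (p n : ℝ)) =o[atTop] (fun n => (T n : ℝ)) →
          (fun n => lsNorm s (β n)) =O[atTop] (fun _ => (1 : ℝ)) →
          TendstoInMeasure μ (fun n ω => sampleMSPE x (T n) (p n) (β n) (bhat n ω)) atTop
            (fun _ => (0 : ℝ))) ∧
      -- consistency for unconstrained `T, p → ∞` and sparse `β`
      (∀ α : ℕ → ℝ, (∀ n, α n ∈ Set.Ioo (0 : ℝ) 1) → ∀ s ∈ Set.Icc (1 : ℝ) 2, ∀ T p : ℕ → ℕ,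
        (∀ n, (T n, p n) ∈ S) → Tendsto T atTop atTop → Tendsto p atTop atTop →
        ∀ (β : ∀ n, Fin (p n) → ℝ) (bhat : ∀ n, Ω → Fin (p n) → ℝ),
          (∀ n, IsPenalizedLSE x (T n) (p n) (β n) (fun t ω => M.err μ t ω ν)
            (regParam Cν (α n) (T n) (p n)) s (bhat n)) →
          (fun n => lsNorm s (β n)) =o[atTop] (fun n => (regParam Cν (α n) (T n) (p n))⁻¹) →
          TendstoInMeasure μ (fun n ω => sampleMSPE x (T n) (p n) (β n) (bhat n ω)) atTop
            (fun _ => (0 : ℝ))) := by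
  obtain ⟨c, K, hP⟩ := hM.exists_isCausalProcess ν
  obtain ⟨C₀, hC₀, h⟩ := mainTheorem7_general (e := fun t ω => M.err μ t ω ν) hP (fun _ => rfl)
    hx.pos hx.bounded hx.spec
  refine ⟨C₀, hC₀, fun Cν hCν => ?_⟩
  obtain ⟨hmoment, hbound, hconsistent, hsparse⟩ := h Cν hCν
  exact ⟨hmoment, fun α hα => hbound α hα.1, fun α hα s hs T p hTp _ =>
      hconsistent α hα.1 s (zero_lt_one.trans_le hs.1) T p hTp,
    fun α hα => hsparse α fun n => Set.Ioo_subset_Ioc_self (hα n)⟩
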